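/- **Corollary (Forward Error Soundness of NumFuzz).** *Language.* Fix an extended pseudo-metric space $(R,d_R)$ (distances in $[0,\infty]$; distinct points may have distance $0$), a grade $\varepsilon\in[0,\infty]$, a function $\rho:R\to R$ with $d_R(x,\rho(x))\le\varepsilon$ for all $x\in R$, and a signature $\Sigma$ of operations $\mathbf{op}:\sigma\multimap\mathrm{num}$ whose argument types $\sigma$ contain no monadic type. Grades $s,t,q,r$ range over $[0,\infty]$ with $0\cdot\infty=\infty\cdot 0=0$. The syntax is $$\sigma,\tau ::= \mathrm{unit}\mid\mathrm{num}\mid\sigma\mathbin{\&}\tau\mid\sigma\otimes\tau\mid\sigma+\tau\mid\sigma\multimap\tau\mid{!_s}\sigma\mid M_q\tau,$$ $$v,w ::= x\mid()\mid k\in R\mid\langle v,w\rangle\mid(v,w)\mid\mathbf{inl}\,v\mid\mathbf{inr}\,v\mid\lambda x.e\mid[v]\mid\mathbf{ret}\,v,$$ $$e,f ::= v\mid \mathbf{rnd}\,v\mid v\,w\mid\pi_i v\mid\mathbf{let}\,(x,y)=v\,\mathbf{in}\,e\mid\mathbf{case}\,v\,\mathbf{of}\,(\mathbf{inl}\,x.e\mid\mathbf{inr}\,y.f)\mid\mathbf{let}\,[x]=v\,\mathbf{in}\,e\mid\mathbf{let}_M\,x=e\,\mathbf{in}\,f\mid\mathbf{let}\,x=e\,\mathbf{in}\,f\mid\mathbf{op}(v).$$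 *Typing.* An environment assigns types and grades to variables ($x:_s\sigma$). Sums $\Gamma+\Theta$ (for environments that agree on the types of shared variables) and multiples $s\cdot\Gamma$ act on the grades; $\Gamma\ge\Gamma'$ means that $\Gamma$ contains every variable of $\Gamma'$, with the same type and at least the same grade. The rules are: - $\Gamma\vdash():\mathrm{unit}$; $\Gamma\vdash k:\mathrm{num}$; $\Gamma\vdash x:\sigma$ if $x:_s\sigma\in\Gamma$ with $s\ge1$; - if $\Gamma,x:_1\sigma\vdash e:\tau$ then $\Gamma\vdash\lambda x.e:\sigma\multimap\tau$; if $\Gamma\vdash v:\sigma\multimap\tau$ and $\Theta\vdash w:\sigma$ then $\Gamma+\Theta\vdash v\,w:\tau$; - if $\Gamma\vdash v:\sigma$ and $\Gamma\vdash w:\tau$ then $\Gamma\vdash\langle v,w\rangle:\sigma\mathbin{\&}\tau$; if $\Gamma\vdash v:\tau_1\mathbin{\&}\tau_2$ then $\Gamma\vdash\pi_iv:\tau_i$; - if $\Gamma\vdash v:\sigma$ and $\Theta\vdash w:\tau$ then $\Gamma+\Theta\vdash(v,w):\sigma\otimes\tau$; if $\Gamma\vdash v:\sigma\otimes\tau$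 and $\Theta,x:_s\sigma,y:_s\tau\vdash e:\rho$ then $s\cdot\Gamma+\Theta\vdash\mathbf{let}\,(x,y)=v\,\mathbf{in}\,e:\rho$; - if $\Gamma\vdash v:\sigma$ then $\Gamma\vdash\mathbf{inl}\,v:\sigma+\tau$; if $\Gamma\vdash v:\tau$ then $\Gamma\vdash\mathbf{inr}\,v:\sigma+\tau$; if $\Gamma\vdash v:\sigma+\tau$, $\Theta,x:_s\sigma\vdash e:\rho$, $\Theta,y:_s\tau\vdash f:\rho$ and $s>0$ then $s\cdot\Gamma+\Theta\vdash\mathbf{case}\,v\,\mathbf{of}\,(\mathbf{inl}\,x.e\mid\mathbf{inr}\,y.f):\rho$; - if $\Gamma\vdash v:\sigma$ and $\Delta\ge s\cdot\Gamma$ then $\Delta\vdash[v]:{!_s}\sigma$; if $\Gamma\vdash v:{!_s}\sigma$ and $\Theta,x:_{t\cdot s}\sigma\vdash e:\tau$ then $t\cdot\Gamma+\Theta\vdash\mathbf{let}\,[x]=v\,\mathbf{in}\,e:\tau$; - if $\Gamma\vdash e:\tau$, $\Theta,x:_s\tau\vdash f:\sigma$ and $s>0$ then $s\cdot\Gamma+\Theta\vdash\mathbf{let}\,x=e\,\mathbf{in}\,f:\sigma$;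 - if $\Gamma\vdash v:\tau$ then $\Gamma\vdash\mathbf{ret}\,v:M_0\tau$; if $\Gamma\vdash v:\mathrm{num}$ then $\Gamma\vdash\mathbf{rnd}\,v:M_\varepsilon\mathrm{num}$; if $\Gamma\vdash e:M_q\tau$ and $q\le r$ then $\Gamma\vdash e:M_r\tau$; if $\Gamma\vdash e:M_r\sigma$ and $\Theta,x:_s\sigma\vdash f:M_q\tau$ then $s\cdot\Gamma+\Theta\vdash\mathbf{let}_M\,x=e\,\mathbf{in}\,f:M_{s\cdot r+q}\tau$; - if $\Gamma\vdash v:\sigma$ and $\mathbf{op}:\sigma\multimap\mathrm{num}$ is in $\Sigma$ then $\Gamma\vdash\mathbf{op}(v):\mathrm{num}$. *Interpretation.* Types denote extended pseudo-metric spaces: $[\![\mathrm{unit}]\!]$ is a point, $[\![\mathrm{num}]\!]=(R,d_R)$, $\&$ and $\otimes$ are the product set with the maximum and the sum of the distances, $+$ is the disjoint union with distance $\infty$ between the summands, $\multimap$ is the set of non-expansive maps with the supremum distance, $[\![{!_s}\sigma]\!]$ is $[\![\sigma]\!]$ with its distance multiplied by $s$, and $[\![M_q\tau]\!]=\{(x,y)\in[\![\tau]\!]^2: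 d(x,y)\le q\}$ with $d((x,y),(x',y'))=d(x,x')$. Each operation comes with a function $op$ from the closed values of type $\sigma$ to $R$ and a non-expansive map $[\![\mathbf{op}]\!]:[\![\sigma]\!]\to[\![\mathrm{num}]\!]$. A typing derivation of $\Gamma\vdash e:\tau$ denotes a non-expansive map $[\![\Gamma]\!]\to[\![\tau]\!]$, where $[\![\Gamma]\!]$ is the $\otimes$-product of the spaces $[\![{!_s}\sigma]\!]$ for $x:_s\sigma$ in $\Gamma$; it is defined by recursion in the evident way, with $\mathbf{op}(v)$ interpreted through $[\![\mathbf{op}]\!]$, $\mathbf{ret}\,v$ through $x\mapsto(x,x)$, $\mathbf{rnd}\,v$ through $x\mapsto(x,\rho(x))$, and $\mathbf{let}_M\,x=e\,\mathbf{in}\,f$ sending $g$ to (first component of $[\![f]\!](g,a)$, second component of $[\![f]\!](g,b)$) where $[\![e]\!](g)=(a,b)$. It is assumed that $[\![\mathbf{op}]\!]([\![v]\!])=op(v)$ for every operation and every (derivation of a) closed value $\emptyset\vdash v:\sigma$. *Evaluation.* The relations $\mapsto_{id}$ and $\mapsto_{fp}$ on closed terms are generated by $\mathbf{op}(v)\mapsto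 op(v)$; $(\lambda x.e)\,v\mapsto e[v/x]$; $\pi_i\langle v_1,v_2\rangle\mapsto v_i$; $\mathbf{let}\,[x]=[v]\,\mathbf{in}\,e\mapsto e[v/x]$; $\mathbf{let}_M\,x=\mathbf{ret}\,v\,\mathbf{in}\,f\mapsto f[v/x]$; $\mathbf{let}\,(x,y)=(v,w)\,\mathbf{in}\,e\mapsto e[v/x][w/y]$; the two $\mathbf{case}$ reductions; $\mathbf{let}\,x=v\,\mathbf{in}\,f\mapsto f[v/x]$; $\mathbf{let}_M\,y=(\mathbf{let}_M\,x=\mathbf{rnd}\,v\,\mathbf{in}\,f)\,\mathbf{in}\,g\mapsto\mathbf{let}_M\,x=\mathbf{rnd}\,v\,\mathbf{in}\,(\mathbf{let}_M\,y=f\,\mathbf{in}\,g)$ for $x\notin FV(g)$; reduction of $e$ inside $\mathbf{let}\,x=e\,\mathbf{in}\,f$ and inside $\mathbf{let}_M\,x=e\,\mathbf{in}\,f$; and $\mathbf{rnd}\,k\mapsto_{id}\mathbf{ret}\,k$, respectively $\mathbf{rnd}\,k\mapsto_{fp}\mathbf{ret}\,\rho(k)$. *Claim.* Let $\emptyset\vdash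 e:M_r\,\mathrm{num}$. Then there are numeric constants $v_{id},v_{fp}\in R$ with $e\mapsto_{id}^*\mathbf{ret}\,v_{id}$ and $e\mapsto_{fp}^*\mathbf{ret}\,v_{fp}$; these are the only results of the form $\mathbf{ret}\,v$ that $e$ reduces to under the respective semantics; and $$d_R(v_{id},v_{fp})\le r .$$ -/

import Mathlib

open scoped ENNReal

universe u v

noncomputable section

namespace NumFuzz

/-! ## Syntax -/

/-- Types; the grades `s`, `q` range over `[0, ∞]`. -/
inductive Ty : Type
  | unit : Ty
  | num : Ty
  /-- the additive product `σ & τ` -/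
  | amp (σ τ : Ty) : Ty
  /-- the multiplicative product `σ ⊗ τ` -/
  | tensor (σ τ : Ty) : Ty
  | sum (σ τ : Ty) : Ty
  /-- the linear function type `σ ⊸ τ` -/
  | lolli (σ τ : Ty) : Ty
  /-- the metric scaling type `!_s σ` -/
  | bang (s : ℝ≥0∞) (σ : Ty) : Ty
  /-- the rounding type `M_q τ` -/
  | mon (q : ℝ≥0∞) (τ : Ty) : Ty

/-- No `M_q` occurs in the type. -/
def Ty.MonadFree : Ty → Prop
  | .unit => True
  | .num => True
  | .amp σ τ => σ.MonadFree ∧ τ.MonadFree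
  | .tensor σ τ => σ.MonadFree ∧ τ.MonadFree
  | .sum σ τ => σ.MonadFree ∧ τ.MonadFree
  | .lolli σ τ => σ.MonadFree ∧ τ.MonadFree
  | .bang _ σ => σ.MonadFree
  | .mon _ _ => False

/-- Terms with numeric constants from `R`, operation symbols from `O` and at most `n` free
variables, in de Bruijn style: a binder binds variable `0` of its body. The restriction of
some positions to values is imposed by the typing rules. -/
inductive Term (R : Type u) (O : Type v) : ℕ → Type (max u v)
  | var {n : ℕ} (i : Fin n) : Term R O n
  | star {n : ℕ} : Term R O n
  | const {n : ℕ} (k : R) : Term R O n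
  /-- the additive pair `⟨v, w⟩` -/
  | apair {n : ℕ} (v w : Term R O n) : Term R O n
  /-- the multiplicative pair `(v, w)` -/
  | tpair {n : ℕ} (v w : Term R O n) : Term R O n
  | inl {n : ℕ} (v : Term R O n) : Term R O n
  | inr {n : ℕ} (v : Term R O n) : Term R O n
  | lam {n : ℕ} (e : Term R O (n + 1)) : Term R O n
  /-- `[v]` -/
  | box {n : ℕ} (v : Term R O n) : Term R O n
  | ret {n : ℕ} (v : Term R O n) : Term R O n
  | rnd {n : ℕ} (v : Term R O n) : Term R O n
  | app {n : ℕ} (v w : Term R O n) : Term R O n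
  | fst {n : ℕ} (v : Term R O n) : Term R O n
  | snd {n : ℕ} (v : Term R O n) : Term R O n
  /-- `let (x, y) = v in e`; in `e`, variable `1` is `x` and variable `0` is `y` -/
  | letPair {n : ℕ} (v : Term R O n) (e : Term R O (n + 2)) : Term R O n
  /-- `case v of (inl x. e | inr y. f)` -/
  | case {n : ℕ} (v : Term R O n) (e f : Term R O (n + 1)) : Term R O n
  /-- `let [x] = v in e` -/
  | letBox {n : ℕ} (v : Term R O n) (e : Term R O (n + 1)) : Term R O n
  /-- `let_M x = e in f` -/
  | letM {n : ℕ} (e : Term R O n) (f : Term R O (n + 1)) : Term R O n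
  /-- `let x = e in f` -/
  | letIn {n : ℕ} (e : Term R O n) (f : Term R O (n + 1)) : Term R O n
  | op {n : ℕ} (o : O) (v : Term R O n) : Term R O n

namespace Term

variable {R : Type u} {O : Type v}

/-- The syntactic values of the ideal and floating-point semantics: `rnd v` is not one. -/
inductive IsValue : {n : ℕ} → Term R O n → Prop
  | var {n : ℕ} (i : Fin n) : IsValue (.var i)
  | star {n : ℕ} : IsValue (.star : Term R O n)
  | const {n : ℕ} (k : R) : IsValue (.const k : Term R O n)
  | apair {n : ℕ} {v w : Term R O n} (hv : IsValue v) (hw : IsValue w) : IsValue (.apair v w)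
  | tpair {n : ℕ} {v w : Term R O n} (hv : IsValue v) (hw : IsValue w) : IsValue (.tpair v w)
  | inl {n : ℕ} {v : Term R O n} (hv : IsValue v) : IsValue (.inl v)
  | inr {n : ℕ} {v : Term R O n} (hv : IsValue v) : IsValue (.inr v)
  | lam {n : ℕ} (e : Term R O (n + 1)) : IsValue (.lam e)
  | box {n : ℕ} {v : Term R O n} (hv : IsValue v) : IsValue (.box v)
  | ret {n : ℕ} {v : Term R O n} (hv : IsValue v) : IsValue (.ret v)

/-- A renaming, extended under one binder. -/
def liftRen {m n : ℕ} (ξ : Fin m → Fin n) : Fin (m + 1) → Fin (n + 1) :=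
  Fin.cases 0 (fun i => (ξ i).succ)

def rename : {m n : ℕ} → (Fin m → Fin n) → Term R O m → Term R O n
  | _, _, ξ, .var i => .var (ξ i)
  | _, _, _, .star => .star
  | _, _, _, .const k => .const k
  | _, _, ξ, .apair v w => .apair (rename ξ v) (rename ξ w)
  | _, _, ξ, .tpair v w => .tpair (rename ξ v) (rename ξ w)
  | _, _, ξ, .inl v => .inl (rename ξ v)
  | _, _, ξ, .inr v => .inr (rename ξ v)
  | _, _, ξ, .lam e => .lam (rename (liftRen ξ) e)
  | _, _, ξ, .box v => .box (rename ξ v)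
  | _, _, ξ, .ret v => .ret (rename ξ v)
  | _, _, ξ, .rnd v => .rnd (rename ξ v)
  | _, _, ξ, .app v w => .app (rename ξ v) (rename ξ w)
  | _, _, ξ, .fst v => .fst (rename ξ v)
  | _, _, ξ, .snd v => .snd (rename ξ v)
  | _, _, ξ, .letPair v e => .letPair (rename ξ v) (rename (liftRen (liftRen ξ)) e)
  | _, _, ξ, .case v e f =>
      .case (rename ξ v) (rename (liftRen ξ) e) (rename (liftRen ξ) f)
  | _, _, ξ, .letBox v e => .letBox (rename ξ v) (rename (liftRen ξ) e)
  | _, _, ξ, .letM e f => .letM (rename ξ e) (rename (liftRen ξ) f)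
  | _, _, ξ, .letIn e f => .letIn (rename ξ e) (rename (liftRen ξ) f)
  | _, _, ξ, .op o v => .op o (rename ξ v)

/-- A substitution, extended under one binder. -/
def liftSub {m n : ℕ} (σ : Fin m → Term R O n) : Fin (m + 1) → Term R O (n + 1) :=
  Fin.cases (.var 0) (fun i => rename Fin.succ (σ i))

/-- Simultaneous capture-avoiding substitution. -/
def subst : {m n : ℕ} → (Fin m → Term R O n) → Term R O m → Term R O n
  | _, _, σ, .var i => σ i
  | _, _, _, .star => .star
  | _, _, _, .const k => .const k
  | _, _, σ, .apair v w => .apair (subst σ v) (subst σ w)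
  | _, _, σ, .tpair v w => .tpair (subst σ v) (subst σ w)
  | _, _, σ, .inl v => .inl (subst σ v)
  | _, _, σ, .inr v => .inr (subst σ v)
  | _, _, σ, .lam e => .lam (subst (liftSub σ) e)
  | _, _, σ, .box v => .box (subst σ v)
  | _, _, σ, .ret v => .ret (subst σ v)
  | _, _, σ, .rnd v => .rnd (subst σ v)
  | _, _, σ, .app v w => .app (subst σ v) (subst σ w)
  | _, _, σ, .fst v => .fst (subst σ v)
  | _, _, σ, .snd v => .snd (subst σ v)
  | _, _, σ, .letPair v e => .letPair (subst σ v) (subst (liftSub (liftSub σ)) e)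
  | _, _, σ, .case v e f => .case (subst σ v) (subst (liftSub σ) e) (subst (liftSub σ) f)
  | _, _, σ, .letBox v e => .letBox (subst σ v) (subst (liftSub σ) e)
  | _, _, σ, .letM e f => .letM (subst σ e) (subst (liftSub σ) f)
  | _, _, σ, .letIn e f => .letIn (subst σ e) (subst (liftSub σ) f)
  | _, _, σ, .op o v => .op o (subst σ v)

/-- `e[v/x]` for a closed `v`, where `x` is the only free variable of `e`. -/
def inst (e : Term R O 1) (v : Term R O 0) : Term R O 0 :=
  subst (fun _ => v) e

/-- `e[v/x][w/y]` for closed `v`, `w`, where `x` is variable `1` and `y` is variable `0`. -/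
def inst₂ (e : Term R O 2) (v w : Term R O 0) : Term R O 0 :=
  subst ![w, v] e

end Term

/-! ## Typing -/

/-- A signature: the operation `o` has type `arg o ⊸ num`. -/
structure Signature : Type (v + 1) where
  Op : Type v
  arg : Op → Ty

/-- The type part, or the grade part, of the environment `Γ, x`. -/
def extend {α : Type*} {n : ℕ} (Γ : Fin n → α) (a : α) : Fin (n + 1) → α :=
  Fin.cases a Γ

/-- Typing derivations. An environment over `n` variables is given by its types
`Γ : Fin n → Ty` and its grades `γ : Fin n → [0, ∞]`. All environments of a rule range over the
same variables, a variable outside the domain of an environment being given the grade `0`;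
so the environment `s · γ + θ` has the grades `s * γ i + θ i`. The rule `box` includes
weakening, `s · γ ≤ δ`, which makes weakening admissible for all derivations (for `s = 0` and
`s = ∞` not every environment is of the form `s · γ`). -/
inductive Deriv (R : Type u) (S : Signature.{v}) (ε : ℝ≥0∞) :
    {n : ℕ} → (Fin n → Ty) → (Fin n → ℝ≥0∞) → Term R S.Op n → Ty → Type (max u v)
  | unit {n : ℕ} {Γ : Fin n → Ty} {γ : Fin n → ℝ≥0∞} :
      Deriv R S ε Γ γ .star .unit
  | const {n : ℕ} {Γ : Fin n → Ty} {γ : Fin n → ℝ≥0∞} (k : R) :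
      Deriv R S ε Γ γ (.const k) .num
  | var {n : ℕ} {Γ : Fin n → Ty} {γ : Fin n → ℝ≥0∞} (i : Fin n) (hi : 1 ≤ γ i) :
      Deriv R S ε Γ γ (.var i) (Γ i)
  | lam {n : ℕ} {Γ : Fin n → Ty} {γ : Fin n → ℝ≥0∞} {σ τ : Ty} {e : Term R S.Op (n + 1)}
      (De : Deriv R S ε (extend Γ σ) (extend γ 1) e τ) :
      Deriv R S ε Γ γ (.lam e) (.lolli σ τ)
  | app {n : ℕ} {Γ : Fin n → Ty} {γ θ : Fin n → ℝ≥0∞} {σ τ : Ty} {v w : Term R S.Op n}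
      (hv : v.IsValue) (hw : w.IsValue)
      (Dv : Deriv R S ε Γ γ v (.lolli σ τ)) (Dw : Deriv R S ε Γ θ w σ) :
      Deriv R S ε Γ (fun i => γ i + θ i) (.app v w) τ
  | apair {n : ℕ} {Γ : Fin n → Ty} {γ : Fin n → ℝ≥0∞} {σ τ : Ty} {v w : Term R S.Op n}
      (hv : v.IsValue) (hw : w.IsValue)
      (Dv : Deriv R S ε Γ γ v σ) (Dw : Deriv R S ε Γ γ w τ) :
      Deriv R S ε Γ γ (.apair v w) (.amp σ τ)
  | fst {n : ℕ} {Γ : Fin n → Ty} {γ : Fin n → ℝ≥0∞} {σ τ : Ty} {v : Term R S.Op n}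
      (hv : v.IsValue) (Dv : Deriv R S ε Γ γ v (.amp σ τ)) :
      Deriv R S ε Γ γ (.fst v) σ
  | snd {n : ℕ} {Γ : Fin n → Ty} {γ : Fin n → ℝ≥0∞} {σ τ : Ty} {v : Term R S.Op n}
      (hv : v.IsValue) (Dv : Deriv R S ε Γ γ v (.amp σ τ)) :
      Deriv R S ε Γ γ (.snd v) τ
  | tpair {n : ℕ} {Γ : Fin n → Ty} {γ θ : Fin n → ℝ≥0∞} {σ τ : Ty} {v w : Term R S.Op n}
      (hv : v.IsValue) (hw : w.IsValue)
      (Dv : Deriv R S ε Γ γ v σ) (Dw : Deriv R S ε Γ θ w τ) :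
      Deriv R S ε Γ (fun i => γ i + θ i) (.tpair v w) (.tensor σ τ)
  | letPair {n : ℕ} {Γ : Fin n → Ty} {γ θ : Fin n → ℝ≥0∞} {s : ℝ≥0∞} {σ τ ρ : Ty}
      {v : Term R S.Op n} {e : Term R S.Op (n + 2)} (hv : v.IsValue)
      (Dv : Deriv R S ε Γ γ v (.tensor σ τ))
      (De : Deriv R S ε (extend (extend Γ σ) τ) (extend (extend θ s) s) e ρ) :
      Deriv R S ε Γ (fun i => s * γ i + θ i) (.letPair v e) ρ
  | inl {n : ℕ} {Γ : Fin n → Ty} {γ : Fin n → ℝ≥0∞} {σ τ : Ty} {v : Term R S.Op n}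
      (hv : v.IsValue) (Dv : Deriv R S ε Γ γ v σ) :
      Deriv R S ε Γ γ (.inl v) (.sum σ τ)
  | inr {n : ℕ} {Γ : Fin n → Ty} {γ : Fin n → ℝ≥0∞} {σ τ : Ty} {v : Term R S.Op n}
      (hv : v.IsValue) (Dv : Deriv R S ε Γ γ v τ) :
      Deriv R S ε Γ γ (.inr v) (.sum σ τ)
  | case {n : ℕ} {Γ : Fin n → Ty} {γ θ : Fin n → ℝ≥0∞} {s : ℝ≥0∞} {σ τ ρ : Ty}
      {v : Term R S.Op n} {e f : Term R S.Op (n + 1)} (hs : 0 < s) (hv : v.IsValue)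
      (Dv : Deriv R S ε Γ γ v (.sum σ τ))
      (De : Deriv R S ε (extend Γ σ) (extend θ s) e ρ)
      (Df : Deriv R S ε (extend Γ τ) (extend θ s) f ρ) :
      Deriv R S ε Γ (fun i => s * γ i + θ i) (.case v e f) ρ
  | box {n : ℕ} {Γ : Fin n → Ty} {γ δ : Fin n → ℝ≥0∞} {s : ℝ≥0∞} {σ : Ty}
      {v : Term R S.Op n} (hδ : ∀ i, s * γ i ≤ δ i) (hv : v.IsValue)
      (Dv : Deriv R S ε Γ γ v σ) :
      Deriv R S ε Γ δ (.box v) (.bang s σ)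
  | letBox {n : ℕ} {Γ : Fin n → Ty} {γ θ : Fin n → ℝ≥0∞} {s t : ℝ≥0∞} {σ τ : Ty}
      {v : Term R S.Op n} {e : Term R S.Op (n + 1)} (hv : v.IsValue)
      (Dv : Deriv R S ε Γ γ v (.bang s σ))
      (De : Deriv R S ε (extend Γ σ) (extend θ (t * s)) e τ) :
      Deriv R S ε Γ (fun i => t * γ i + θ i) (.letBox v e) τ
  | letIn {n : ℕ} {Γ : Fin n → Ty} {γ θ : Fin n → ℝ≥0∞} {s : ℝ≥0∞} {σ τ : Ty}
      {e : Term R S.Op n} {f : Term R S.Op (n + 1)} (hs : 0 < s)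
      (De : Deriv R S ε Γ γ e τ)
      (Df : Deriv R S ε (extend Γ τ) (extend θ s) f σ) :
      Deriv R S ε Γ (fun i => s * γ i + θ i) (.letIn e f) σ
  | ret {n : ℕ} {Γ : Fin n → Ty} {γ : Fin n → ℝ≥0∞} {τ : Ty} {v : Term R S.Op n}
      (hv : v.IsValue) (Dv : Deriv R S ε Γ γ v τ) :
      Deriv R S ε Γ γ (.ret v) (.mon 0 τ)
  | rnd {n : ℕ} {Γ : Fin n → Ty} {γ : Fin n → ℝ≥0∞} {v : Term R S.Op n}
      (hv : v.IsValue) (Dv : Deriv R S ε Γ γ v .num) :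
      Deriv R S ε Γ γ (.rnd v) (.mon ε .num)
  | msub {n : ℕ} {Γ : Fin n → Ty} {γ : Fin n → ℝ≥0∞} {q r : ℝ≥0∞} {τ : Ty}
      {e : Term R S.Op n} (hqr : q ≤ r) (De : Deriv R S ε Γ γ e (.mon q τ)) :
      Deriv R S ε Γ γ e (.mon r τ)
  | letM {n : ℕ} {Γ : Fin n → Ty} {γ θ : Fin n → ℝ≥0∞} {s r q : ℝ≥0∞} {σ τ : Ty}
      {e : Term R S.Op n} {f : Term R S.Op (n + 1)}
      (De : Deriv R S ε Γ γ e (.mon r σ))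
      (Df : Deriv R S ε (extend Γ σ) (extend θ s) f (.mon q τ)) :
      Deriv R S ε Γ (fun i => s * γ i + θ i) (.letM e f) (.mon (s * r + q) τ)
  | op {n : ℕ} {Γ : Fin n → Ty} {γ : Fin n → ℝ≥0∞} (o : S.Op) {v : Term R S.Op n}
      (hv : v.IsValue) (Dv : Deriv R S ε Γ γ v (S.arg o)) :
      Deriv R S ε Γ γ (.op o v) .num

/-- Derivations of `∅ ⊢ e : τ`. -/
abbrev ClosedDeriv (R : Type u) (S : Signature.{v}) (ε : ℝ≥0∞) (e : Term R S.Op 0) (τ : Ty) :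
    Type (max u v) :=
  Deriv R S ε ![] ![] e τ

/-- `CV(τ)`, the closed values of type `τ`. -/
def ClosedValue (R : Type u) (S : Signature.{v}) (ε : ℝ≥0∞) (τ : Ty) : Type (max u v) :=
  {v : Term R S.Op 0 // v.IsValue ∧ Nonempty (ClosedDeriv R S ε v τ)}

/-! ## Operational semantics -/

/-- The step relation on closed terms in which `rnd k` steps to `ret (round k)`. The ideal
semantics is the case `round = id`, the floating-point semantics the case `round = ρ`. -/
inductive Step {R : Type u} {S : Signature.{v}} {ε : ℝ≥0∞}
    (opFun : ∀ o : S.Op, ClosedValue R S ε (S.arg o) → R) (round : R → R) :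
    Term R S.Op 0 → Term R S.Op 0 → Prop
  | op (o : S.Op) (v : ClosedValue R S ε (S.arg o)) :
      Step opFun round (.op o v.1) (.const (opFun o v))
  | app (e : Term R S.Op 1) {v : Term R S.Op 0} (hv : v.IsValue) :
      Step opFun round (.app (.lam e) v) (e.inst v)
  | fst {v w : Term R S.Op 0} (hv : v.IsValue) (hw : w.IsValue) :
      Step opFun round (.fst (.apair v w)) v
  | snd {v w : Term R S.Op 0} (hv : v.IsValue) (hw : w.IsValue) :
      Step opFun round (.snd (.apair v w)) w
  | letBox {v : Term R S.Op 0} (hv : v.IsValue) (e : Term R S.Op 1) :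
      Step opFun round (.letBox (.box v) e) (e.inst v)
  | letRet {v : Term R S.Op 0} (hv : v.IsValue) (f : Term R S.Op 1) :
      Step opFun round (.letM (.ret v) f) (f.inst v)
  | letPair {v w : Term R S.Op 0} (hv : v.IsValue) (hw : w.IsValue) (e : Term R S.Op 2) :
      Step opFun round (.letPair (.tpair v w) e) (e.inst₂ v w)
  | caseInl {v : Term R S.Op 0} (hv : v.IsValue) (e f : Term R S.Op 1) :
      Step opFun round (.case (.inl v) e f) (e.inst v)
  | caseInr {v : Term R S.Op 0} (hv : v.IsValue) (e f : Term R S.Op 1) :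
      Step opFun round (.case (.inr v) e f) (f.inst v)
  | letVal {v : Term R S.Op 0} (hv : v.IsValue) (f : Term R S.Op 1) :
      Step opFun round (.letIn v f) (f.inst v)
  /-- `let_M y = (let_M x = rnd v in f) in g` steps to `let_M x = rnd v in let_M y = f in g`;
  the renaming of `g` skips `x`. -/
  | letAssoc {v : Term R S.Op 0} (hv : v.IsValue) (f g : Term R S.Op 1) :
      Step opFun round (.letM (.letM (.rnd v) f) g)
        (.letM (.rnd v) (.letM f (g.rename (Term.liftRen Fin.succ))))
  | rnd (k : R) : Step opFun round (.rnd (.const k)) (.ret (.const (round k)))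
  | letCongr {e e' : Term R S.Op 0} (f : Term R S.Op 1) (h : Step opFun round e e') :
      Step opFun round (.letIn e f) (.letIn e' f)
  | letMCongr {e e' : Term R S.Op 0} (f : Term R S.Op 1) (h : Step opFun round e e') :
      Step opFun round (.letM e f) (.letM e' f)

/-- The reflexive transitive closure of the step relation. -/
def Steps {R : Type u} {S : Signature.{v}} {ε : ℝ≥0∞}
    (opFun : ∀ o : S.Op, ClosedValue R S ε (S.arg o) → R) (round : R → R) :
    Term R S.Op 0 → Term R S.Op 0 → Prop :=
  Relation.ReflTransGen (Step opFun round)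

/-! ## Metric spaces -/

/-- Extended pseudo-metric spaces, the objects of `Met`. -/
structure Met : Type (u + 1) where
  carrier : Type u
  d : carrier → carrier → ℝ≥0∞
  d_self : ∀ x, d x x = 0
  d_comm : ∀ x y, d x y = d y x
  d_triangle : ∀ x y z, d x z ≤ d x y + d y z

namespace Met

instance : CoeSort Met.{u} (Type u) := ⟨Met.carrier⟩

/-- The space `(R, d_R)`. -/
abbrev of (R : Type u) [PseudoEMetricSpace R] : Met.{u} where
  carrier := R
  d := edist
  d_self := edist_self
  d_comm := edist_comm
  d_triangle := edist_triangle

/-- Non-expansive maps, the morphisms of `Met`. -/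
structure Hom (A B : Met.{u}) : Type u where
  toFun : A → B
  nonexp : ∀ x y, B.d (toFun x) (toFun y) ≤ A.d x y

instance (A B : Met.{u}) : CoeFun (Hom A B) (fun _ => A → B) := ⟨Hom.toFun⟩

abbrev point : Met.{u} where
  carrier := PUnit
  d _ _ := 0
  d_self _ := rfl
  d_comm _ _ := rfl
  d_triangle _ _ _ := zero_le

/-- The Cartesian product `A & B`, with the maximum distance. -/
abbrev amp (A B : Met.{u}) : Met.{u} where
  carrier := A × B
  d x y := max (A.d x.1 y.1) (B.d x.2 y.2)
  d_self x := by simp [A.d_self, B.d_self]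
  d_comm x y := by rw [A.d_comm, B.d_comm]
  d_triangle x y z := max_le
    ((A.d_triangle _ y.1 _).trans (add_le_add (le_max_left _ _) (le_max_left _ _)))
    ((B.d_triangle _ y.2 _).trans (add_le_add (le_max_right _ _) (le_max_right _ _)))

/-- The tensor product `A ⊗ B`, with the sum of the distances. -/
abbrev tensor (A B : Met.{u}) : Met.{u} where
  carrier := A × B
  d x y := A.d x.1 y.1 + B.d x.2 y.2
  d_self x := by simp [A.d_self, B.d_self]
  d_comm x y := by rw [A.d_comm, B.d_comm]
  d_triangle x y z := by
    rw [add_add_add_comm]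
    exact add_le_add (A.d_triangle _ _ _) (B.d_triangle _ _ _)

/-- The distance on a disjoint union: `∞` between the two summands. -/
def sumDist (A B : Met.{u}) : A ⊕ B → A ⊕ B → ℝ≥0∞
  | .inl a, .inl a' => A.d a a'
  | .inr b, .inr b' => B.d b b'
  | .inl _, .inr _ => ⊤
  | .inr _, .inl _ => ⊤

/-- The coproduct `A + B`. -/
abbrev sum (A B : Met.{u}) : Met.{u} where
  carrier := A ⊕ B
  d := sumDist A B
  d_self x := by rcases x with a | b <;> simp [sumDist, A.d_self, B.d_self]
  d_comm x y := by
    rcases x with a | b <;> rcases y with a' | b' <;> simp [sumDist, A.d_comm, B.d_comm]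
  d_triangle x y z := by
    rcases x with a | b <;> rcases y with a' | b' <;> rcases z with a'' | b'' <;>
      simp [sumDist, A.d_triangle, B.d_triangle]

/-- The space `A ⊸ B` of non-expansive maps, with the supremum distance. -/
abbrev lolli (A B : Met.{u}) : Met.{u} where
  carrier := Hom A B
  d f g := ⨆ a, B.d (f a) (g a)
  d_self f := by simp [B.d_self]
  d_comm f g := by simp only [B.d_comm]
  d_triangle f g h := iSup_le fun a => (B.d_triangle _ (g a) _).trans
    (add_le_add (le_iSup (fun a => B.d (f a) (g a)) a) (le_iSup (fun a => B.d (g a) (h a)) a))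

/-- The scaling comonad `D_s`. -/
abbrev scale (s : ℝ≥0∞) (A : Met.{u}) : Met.{u} where
  carrier := A
  d x y := s * A.d x y
  d_self x := by simp [A.d_self]
  d_comm x y := by rw [A.d_comm]
  d_triangle x y z := by
    rw [← mul_add]
    exact mul_le_mul_right (A.d_triangle _ _ _) s

/-- The neighborhood monad `T_r`. -/
abbrev nbhd (r : ℝ≥0∞) (A : Met.{u}) : Met.{u} where
  carrier := {p : A × A // A.d p.1 p.2 ≤ r}
  d p q := A.d p.1.1 q.1.1
  d_self _ := A.d_self _
  d_comm _ _ := A.d_comm _ _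
  d_triangle _ _ _ := A.d_triangle _ _ _

end Met

/-! ## Metric semantics -/

/-- The interpretation `⟦τ⟧` of types, for `⟦num⟧ = N`. -/
def Ty.den (N : Met.{u}) : Ty → Met.{u}
  | .unit => Met.point
  | .num => N
  | .amp σ τ => Met.amp (σ.den N) (τ.den N)
  | .tensor σ τ => Met.tensor (σ.den N) (τ.den N)
  | .sum σ τ => Met.sum (σ.den N) (τ.den N)
  | .lolli σ τ => Met.lolli (σ.den N) (τ.den N)
  | .bang s σ => Met.scale s (σ.den N)
  | .mon q τ => Met.nbhd q (τ.den N)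

/-- The points of `⟦Γ⟧`. -/
abbrev Env (N : Met.{u}) {n : ℕ} (Γ : Fin n → Ty) : Type u :=
  (i : Fin n) → (Γ i).den N

/-- The distance of the tensor product of the spaces `D_{γ i} ⟦Γ i⟧`. -/
def ctxDist (N : Met.{u}) {n : ℕ} (Γ : Fin n → Ty) (γ : Fin n → ℝ≥0∞) (g h : Env N Γ) : ℝ≥0∞ :=
  ∑ i, γ i * ((Γ i).den N).d (g i) (h i)

/-- The interpretation of an environment: the tensor product of the spaces `D_{γ i} ⟦Γ i⟧`. -/
abbrev ctx (N : Met.{u}) {n : ℕ} (Γ : Fin n → Ty) (γ : Fin n → ℝ≥0∞) : Met.{u} where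
  carrier := Env N Γ
  d := ctxDist N Γ γ
  d_self g := by simp [ctxDist, Met.d_self]
  d_comm g h := by simp only [ctxDist, Met.d_comm]
  d_triangle g h k := by
    unfold ctxDist
    rw [← Finset.sum_add_distrib]
    refine Finset.sum_le_sum fun i _ => ?_
    rw [← mul_add]
    exact mul_le_mul_right (Met.d_triangle _ _ _ _) _

section Combinators

variable {N : Met.{u}} {n : ℕ} {Γ : Fin n → Ty} {γ θ : Fin n → ℝ≥0∞}

/-- The extension of `g ∈ ⟦Γ⟧` by a value for a new variable. -/
def consEnv {σ : Ty} (g : Env N Γ) (a : σ.den N) : Env N (extend Γ σ) :=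
  fun i => Fin.cases (motive := fun i => (extend Γ σ i).den N) a g i

theorem ctxDist_cons {σ : Ty} {s : ℝ≥0∞} (g h : Env N Γ) (a b : σ.den N) :
    ctxDist N (extend Γ σ) (extend θ s) (consEnv g a) (consEnv h b) =
      s * (σ.den N).d a b + ctxDist N Γ θ g h := by
  unfold ctxDist
  rw [Fin.sum_univ_succ]
  rfl

theorem ctxDist_add (g h : Env N Γ) :
    ctxDist N Γ (fun i => γ i + θ i) g h = ctxDist N Γ γ g h + ctxDist N Γ θ g h := by
  simp only [ctxDist, add_mul, Finset.sum_add_distrib]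

theorem ctxDist_scale (s : ℝ≥0∞) (g h : Env N Γ) :
    ctxDist N Γ (fun i => s * γ i) g h = s * ctxDist N Γ γ g h := by
  simp only [ctxDist, mul_assoc, Finset.mul_sum]

theorem ctxDist_split (s : ℝ≥0∞) (g h : Env N Γ) :
    ctxDist N Γ (fun i => s * γ i + θ i) g h =
      s * ctxDist N Γ γ g h + ctxDist N Γ θ g h := by
  rw [ctxDist_add (γ := fun i => s * γ i), ctxDist_scale]

theorem ctxDist_mono {γ δ : Fin n → ℝ≥0∞} (h : ∀ i, γ i ≤ δ i) (g g' : Env N Γ) :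
    ctxDist N Γ γ g g' ≤ ctxDist N Γ δ g g' :=
  Finset.sum_le_sum fun i _ => mul_le_mul_left (h i) _

theorem ctxDist_self (g : Env N Γ) : ctxDist N Γ γ g g = 0 :=
  (ctx N Γ γ).d_self g

/-- A body with a bound variable of sensitivity `s`, applied to the value bound to it. -/
theorem bind_nonexp {σ : Ty} {s c : ℝ≥0∞} {B : Met.{u}}
    (k : Met.Hom (ctx N (extend Γ σ) (extend θ s)) B) {g h : Env N Γ} {a b : σ.den N}
    (hab : s * (σ.den N).d a b ≤ c) :
    B.d (k (consEnv g a)) (k (consEnv h b)) ≤ c + ctxDist N Γ θ g h :=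
  ((k.nonexp _ _).trans (ctxDist_cons g h a b).le).trans (add_le_add hab le_rfl)

def constHom {A B : Met.{u}} (b : B) : Met.Hom A B where
  toFun _ := b
  nonexp _ _ := (B.d_self b).trans_le zero_le

def compHom {A B C : Met.{u}} (g : Met.Hom B C) (f : Met.Hom A B) : Met.Hom A C where
  toFun x := g (f x)
  nonexp _ _ := (g.nonexp _ _).trans (f.nonexp _ _)

def varHom (i : Fin n) (hi : 1 ≤ γ i) : Met.Hom (ctx N Γ γ) ((Γ i).den N) where
  toFun g := g i
  nonexp g h :=
    (le_mul_of_one_le_left zero_le hi).trans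
      (Finset.single_le_sum (f := fun i => γ i * ((Γ i).den N).d (g i) (h i))
        (fun _ _ => zero_le) (Finset.mem_univ i))

def lamHom {σ : Ty} {B : Met.{u}} (k : Met.Hom (ctx N (extend Γ σ) (extend γ 1)) B) :
    Met.Hom (ctx N Γ γ) (Met.lolli (σ.den N) B) where
  toFun g :=
    { toFun := fun a => k (consEnv g a)
      nonexp := fun a b =>
        (bind_nonexp k (one_mul _).le).trans
          (by rw [ctxDist_self, add_zero]) }
  nonexp g h := iSup_le fun a =>
    (bind_nonexp k (c := 0) (by rw [Met.d_self, mul_zero])).trans (zero_add _).le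

def appHom {A B : Met.{u}} (f : Met.Hom (ctx N Γ γ) (Met.lolli A B))
    (x : Met.Hom (ctx N Γ θ) A) : Met.Hom (ctx N Γ (fun i => γ i + θ i)) B where
  toFun g := (f g).toFun (x g)
  nonexp g h :=
    ((B.d_triangle _ ((f h).toFun (x g)) _).trans (add_le_add
      ((le_iSup (fun a => B.d ((f g).toFun a) ((f h).toFun a)) (x g)).trans (f.nonexp g h))
      (((f h).nonexp _ _).trans (x.nonexp g h)))).trans (ctxDist_add g h).ge

def apairHom {A B C : Met.{u}} (f : Met.Hom C A) (f' : Met.Hom C B) :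
    Met.Hom C (Met.amp A B) where
  toFun g := (f g, f' g)
  nonexp g h := max_le (f.nonexp g h) (f'.nonexp g h)

def fstHom {A B : Met.{u}} : Met.Hom (Met.amp A B) A where
  toFun p := p.1
  nonexp _ _ := le_max_left _ _

def sndHom {A B : Met.{u}} : Met.Hom (Met.amp A B) B where
  toFun p := p.2
  nonexp _ _ := le_max_right _ _

def tpairHom {A B : Met.{u}} (f : Met.Hom (ctx N Γ γ) A) (f' : Met.Hom (ctx N Γ θ) B) :
    Met.Hom (ctx N Γ (fun i => γ i + θ i)) (Met.tensor A B) where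
  toFun g := (f g, f' g)
  nonexp g h := (add_le_add (f.nonexp g h) (f'.nonexp g h)).trans (ctxDist_add g h).ge

def letPairHom {σ τ : Ty} {s : ℝ≥0∞} {B : Met.{u}}
    (f : Met.Hom (ctx N Γ γ) (Met.tensor (σ.den N) (τ.den N)))
    (k : Met.Hom (ctx N (extend (extend Γ σ) τ) (extend (extend θ s) s)) B) :
    Met.Hom (ctx N Γ (fun i => s * γ i + θ i)) B where
  toFun g := k (consEnv (consEnv g (f g).1) (f g).2)
  nonexp g h := by
    refine ((bind_nonexp k le_rfl).trans_eq
      (congrArg (s * (τ.den N).d (f g).2 (f h).2 + ·)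
        (ctxDist_cons g h (f g).1 (f h).1))).trans ?_
    refine le_trans ?_ (ctxDist_split s g h).ge
    rw [← add_assoc, ← mul_add, add_comm ((τ.den N).d _ _)]
    exact add_le_add (mul_le_mul_right (f.nonexp g h) s) le_rfl

def inlHom {A B : Met.{u}} : Met.Hom A (Met.sum A B) where
  toFun := Sum.inl
  nonexp _ _ := le_rfl

def inrHom {A B : Met.{u}} : Met.Hom B (Met.sum A B) where
  toFun := Sum.inr
  nonexp _ _ := le_rfl

/-- The copairing `[k, k']` at a point of `⟦Γ⟧`. -/
def caseFun {σ τ : Ty} {s : ℝ≥0∞} {B : Met.{u}}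
    (k : Met.Hom (ctx N (extend Γ σ) (extend θ s)) B)
    (k' : Met.Hom (ctx N (extend Γ τ) (extend θ s)) B) (g : Env N Γ) :
    σ.den N ⊕ τ.den N → B
  | .inl a => k (consEnv g a)
  | .inr b => k' (consEnv g b)

theorem caseFun_nonexp {σ τ : Ty} {s c : ℝ≥0∞} {B : Met.{u}} (hs : 0 < s)
    (k : Met.Hom (ctx N (extend Γ σ) (extend θ s)) B)
    (k' : Met.Hom (ctx N (extend Γ τ) (extend θ s)) B) (g h : Env N Γ)
    (x y : σ.den N ⊕ τ.den N) (H : Met.sumDist _ _ x y ≤ c) :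
    B.d (caseFun k k' g x) (caseFun k k' h y) ≤ s * c + ctxDist N Γ θ g h := by
  have htop : (⊤ : ℝ≥0∞) ≤ c → s * c = ⊤ := fun H => by
    rw [top_le_iff.1 H, ENNReal.mul_top hs.ne']
  rcases x with a | b <;> rcases y with a' | b'
  · exact bind_nonexp k (mul_le_mul_right H s)
  · rw [htop H, top_add]; exact le_top
  · rw [htop H, top_add]; exact le_top
  · exact bind_nonexp k' (mul_le_mul_right H s)

def caseHom {σ τ : Ty} {s : ℝ≥0∞} {B : Met.{u}} (hs : 0 < s)
    (f : Met.Hom (ctx N Γ γ) (Met.sum (σ.den N) (τ.den N)))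
    (k : Met.Hom (ctx N (extend Γ σ) (extend θ s)) B)
    (k' : Met.Hom (ctx N (extend Γ τ) (extend θ s)) B) :
    Met.Hom (ctx N Γ (fun i => s * γ i + θ i)) B where
  toFun g := caseFun k k' g (f g)
  nonexp g h :=
    (caseFun_nonexp hs k k' g h (f g) (f h) (f.nonexp g h)).trans (ctxDist_split s g h).ge

def boxHom {A : Met.{u}} {s : ℝ≥0∞} {δ : Fin n → ℝ≥0∞} (hδ : ∀ i, s * γ i ≤ δ i)
    (f : Met.Hom (ctx N Γ γ) A) : Met.Hom (ctx N Γ δ) (Met.scale s A) where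
  toFun g := f g
  nonexp g h :=
    ((mul_le_mul_right (f.nonexp g h) s).trans (ctxDist_scale s g h).ge).trans
      (ctxDist_mono hδ g h)

def letBoxHom {σ : Ty} {s t : ℝ≥0∞} {B : Met.{u}}
    (f : Met.Hom (ctx N Γ γ) (Met.scale s (σ.den N)))
    (k : Met.Hom (ctx N (extend Γ σ) (extend θ (t * s))) B) :
    Met.Hom (ctx N Γ (fun i => t * γ i + θ i)) B where
  toFun g := k (consEnv g (f g))
  nonexp g h :=
    (bind_nonexp k ((mul_assoc _ _ _).trans_le (mul_le_mul_right (f.nonexp g h) t))).trans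
      (ctxDist_split t g h).ge

def letInHom {τ : Ty} {s : ℝ≥0∞} {B : Met.{u}} (f : Met.Hom (ctx N Γ γ) (τ.den N))
    (k : Met.Hom (ctx N (extend Γ τ) (extend θ s)) B) :
    Met.Hom (ctx N Γ (fun i => s * γ i + θ i)) B where
  toFun g := k (consEnv g (f g))
  nonexp g h :=
    (bind_nonexp k (mul_le_mul_right (f.nonexp g h) s)).trans (ctxDist_split s g h).ge

/-- The unit `x ↦ (x, x)` of the neighborhood monad. -/
def retHom {A : Met.{u}} : Met.Hom A (Met.nbhd 0 A) where
  toFun x := ⟨(x, x), (A.d_self x).le⟩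
  nonexp _ _ := le_rfl

/-- The map `x ↦ (x, ρ x)`. -/
def rndHom {A : Met.{u}} {ε : ℝ≥0∞} (ρ : A → A) (hρ : ∀ x, A.d x (ρ x) ≤ ε) :
    Met.Hom A (Met.nbhd ε A) where
  toFun x := ⟨(x, ρ x), hρ x⟩
  nonexp _ _ := le_rfl

def msubHom {A : Met.{u}} {q r : ℝ≥0∞} (hqr : q ≤ r) : Met.Hom (Met.nbhd q A) (Met.nbhd r A) where
  toFun p := ⟨p.1, p.2.trans hqr⟩
  nonexp _ _ := le_rfl

/-- Sequencing: if `f g = (x, y)`, the result is the first component of `k (g, x)` together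
with the second component of `k (g, y)`. -/
def letMHom {σ : Ty} {s r q : ℝ≥0∞} {B : Met.{u}}
    (f : Met.Hom (ctx N Γ γ) (Met.nbhd r (σ.den N)))
    (k : Met.Hom (ctx N (extend Γ σ) (extend θ s)) (Met.nbhd q B)) :
    Met.Hom (ctx N Γ (fun i => s * γ i + θ i)) (Met.nbhd (s * r + q) B) where
  toFun g := ⟨((k (consEnv g (f g).1.1)).1.1, (k (consEnv g (f g).1.2)).1.2),
    (B.d_triangle _ ((k (consEnv g (f g).1.2)).1.1) _).trans
      (add_le_add ((bind_nonexp k (mul_le_mul_right (f g).2 s)).trans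
        (by rw [ctxDist_self, add_zero])) (k (consEnv g (f g).1.2)).2)⟩
  nonexp g h :=
    (bind_nonexp k (mul_le_mul_right (f.nonexp g h) s)).trans (ctxDist_split s g h).ge

end Combinators

/-- The interpretation `⟦Γ ⊢ e : τ⟧ : ⟦Γ⟧ → ⟦τ⟧` in `Met`, by recursion on the derivation, for
a rounding function `ρ` and non-expansive interpretations `opDen` of the operations. -/
def denote {R : Type u} [PseudoEMetricSpace R] {S : Signature.{v}} {ε : ℝ≥0∞} (ρ : R → R)
    (hρ : ∀ x, edist x (ρ x) ≤ ε)
    (opDen : ∀ o : S.Op, Met.Hom ((S.arg o).den (Met.of R)) (Met.of R)) :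
    {n : ℕ} → {Γ : Fin n → Ty} → {γ : Fin n → ℝ≥0∞} → {e : Term R S.Op n} → {τ : Ty} →
    Deriv R S ε Γ γ e τ → Met.Hom (ctx (Met.of R) Γ γ) (τ.den (Met.of R))
  | _, _, _, _, _, .unit => constHom PUnit.unit
  | _, _, _, _, _, .const k => constHom k
  | _, Γ, _, _, .(Γ i), .var i hi => varHom i hi
  | _, _, _, _, _, .lam De => lamHom (denote ρ hρ opDen De)
  | _, _, _, _, _, .app _ _ Dv Dw => appHom (denote ρ hρ opDen Dv) (denote ρ hρ opDen Dw)
  | _, _, _, _, _, .apair _ _ Dv Dw => apairHom (denote ρ hρ opDen Dv) (denote ρ hρ opDen Dw)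
  | _, _, _, _, _, .fst _ Dv => compHom fstHom (denote ρ hρ opDen Dv)
  | _, _, _, _, _, .snd _ Dv => compHom sndHom (denote ρ hρ opDen Dv)
  | _, _, _, _, _, .tpair _ _ Dv Dw => tpairHom (denote ρ hρ opDen Dv) (denote ρ hρ opDen Dw)
  | _, _, _, _, _, .letPair _ Dv De => letPairHom (denote ρ hρ opDen Dv) (denote ρ hρ opDen De)
  | _, _, _, _, _, .inl _ Dv => compHom inlHom (denote ρ hρ opDen Dv)
  | _, _, _, _, _, .inr _ Dv => compHom inrHom (denote ρ hρ opDen Dv)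
  | _, _, _, _, _, .case hs _ Dv De Df =>
      caseHom hs (denote ρ hρ opDen Dv) (denote ρ hρ opDen De) (denote ρ hρ opDen Df)
  | _, _, _, _, _, .box hδ _ Dv => boxHom hδ (denote ρ hρ opDen Dv)
  | _, _, _, _, _, .letBox _ Dv De => letBoxHom (denote ρ hρ opDen Dv) (denote ρ hρ opDen De)
  | _, _, _, _, _, .letIn _ De Df => letInHom (denote ρ hρ opDen De) (denote ρ hρ opDen Df)
  | _, _, _, _, _, .ret _ Dv => compHom retHom (denote ρ hρ opDen Dv)
  | _, _, _, _, _, .rnd _ Dv =>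
      compHom (rndHom (A := Met.of R) ρ hρ) (denote ρ hρ opDen Dv)
  | _, _, _, _, _, .msub hqr De => compHom (msubHom hqr) (denote ρ hρ opDen De)
  | _, _, _, _, _, .letM De Df => letMHom (denote ρ hρ opDen De) (denote ρ hρ opDen Df)
  | _, _, _, _, _, .op o _ Dv => compHom (opDen o) (denote ρ hρ opDen Dv)

/-- `⟦∅ ⊢ e : τ⟧` as an element of `⟦τ⟧`. -/
def denoteClosed {R : Type u} [PseudoEMetricSpace R] {S : Signature.{v}} {ε : ℝ≥0∞} (ρ : R → R)
    (hρ : ∀ x, edist x (ρ x) ≤ ε)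
    (opDen : ∀ o : S.Op, Met.Hom ((S.arg o).den (Met.of R)) (Met.of R))
    {e : Term R S.Op 0} {τ : Ty} (D : ClosedDeriv R S ε e τ) : τ.den (Met.of R) :=
  denote ρ hρ opDen D (fun i => i.elim0)

end NumFuzz

end

/-!
A closed derivation `D` of `∅ ⊢ e : M_r num` denotes a pair `(a, b)` of points of `R` with
`edist a b ≤ r`. The proof shows that `e` evaluates to `ret a` in the ideal semantics and to `ret b`
in the floating-point semantics; the error bound is then part of the denotation.

Both evaluations come from a logical relation `Comp` between closed values and points of `⟦τ⟧`,
which depends on the semantics `m` considered: a value `ret v` implements a point of `⟦M_q τ⟧` if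
`v` implements the component of that point selected by `m`. By the fundamental lemma
`exists_eval_comp`, every term evaluates to a value that implements its denotation. In particular
evaluation terminates.

The difficult case is `op(v)`, since the hypothesis on `opDen` concerns only denotations of closed
values. If `w` are closed values that implement `g`, then `⟦v⟧ g` need not be the denotation of the
closed value `v[w]`: an entry of `g` of type `M_q τ` is a pair `(a, b)`, while the value for it may
denote `(b, b)`. So `Comp` also asks that the value have a derivation whose denotation agrees with
the given point in the component selected by `m` (`Agree`). Denotations preserve this agreement
(`agree_denote`), substitution composes denotations (`hasDen_subst_closed`), and on types without
`M` agreement is equality (`agree_iff_eq`); together these give `⟦v[w]⟧ = ⟦v⟧ g` for the argument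
of an operation.

Uniqueness of the results is not immediate, because the rule `letAssoc` makes the step relation
nondeterministic. The deterministic big-step relation `Eval` is contained in `Steps`, and it is
closed under expansion by single steps (`Step.eval`), so that every reduction to a term `ret v`
is an evaluation.
-/

namespace NumFuzz

/-! ### Substitution -/

namespace Term

variable {R : Type u} {O : Type v}

theorem liftRen_comp {l m n : ℕ} (ξ : Fin l → Fin m) (ζ : Fin m → Fin n) :
    liftRen ζ ∘ liftRen ξ = liftRen (ζ ∘ ξ) := by
  funext i
  cases i using Fin.cases <;> rfl

theorem liftSub_comp_liftRen {l m n : ℕ} (ξ : Fin l → Fin m) (σ : Fin m → Term R O n) :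
    liftSub σ ∘ liftRen ξ = liftSub (σ ∘ ξ) := by
  funext i
  cases i using Fin.cases <;> rfl

theorem rename_rename {l m n : ℕ} (ξ : Fin l → Fin m) (ζ : Fin m → Fin n) (e : Term R O l) :
    rename ζ (rename ξ e) = rename (ζ ∘ ξ) e := by
  induction e generalizing m n <;> simp_all only [Function.comp_apply, rename, liftRen_comp]

theorem subst_rename {l m n : ℕ} (ξ : Fin l → Fin m) (σ : Fin m → Term R O n) (e : Term R O l) :
    subst σ (rename ξ e) = subst (σ ∘ ξ) e := by
  induction e generalizing m n <;>
    simp_all only [Function.comp_apply, rename, subst, liftSub_comp_liftRen]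

theorem rename_comp_liftSub {l m n : ℕ} (σ : Fin l → Term R O m) (ξ : Fin m → Fin n) :
    rename (liftRen ξ) ∘ liftSub σ = liftSub (rename ξ ∘ σ) := by
  funext i
  cases i using Fin.cases with
  | zero => rfl
  | succ i => exact (rename_rename Fin.succ _ (σ i)).trans (rename_rename ξ Fin.succ (σ i)).symm

theorem rename_subst {l m n : ℕ} (σ : Fin l → Term R O m) (ξ : Fin m → Fin n) (e : Term R O l) :
    rename ξ (subst σ e) = subst (rename ξ ∘ σ) e := by
  induction e generalizing m n <;>
    simp_all only [Function.comp_apply, rename, subst, rename_comp_liftSub]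

theorem subst_comp_liftSub {l m n : ℕ} (σ : Fin l → Term R O m) (τ : Fin m → Term R O n) :
    subst (liftSub τ) ∘ liftSub σ = liftSub (subst τ ∘ σ) := by
  funext i
  cases i using Fin.cases with
  | zero => rfl
  | succ i => exact (subst_rename _ _ _).trans (rename_subst _ _ _).symm

theorem subst_subst {l m n : ℕ} (σ : Fin l → Term R O m) (τ : Fin m → Term R O n)
    (e : Term R O l) : subst τ (subst σ e) = subst (subst τ ∘ σ) e := by
  induction e generalizing m n <;> simp_all only [Function.comp_apply, subst, subst_comp_liftSub]

theorem liftSub_var {n : ℕ} : liftSub (var : Fin n → Term R O n) = var := by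
  funext i
  cases i using Fin.cases <;> rfl

theorem subst_var {n : ℕ} (e : Term R O n) : subst var e = e := by
  induction e <;> simp_all only [subst, liftSub_var]

theorem subst_var_comp {m n : ℕ} (ξ : Fin m → Fin n) (e : Term R O m) :
    subst (var ∘ ξ) e = rename ξ e := by
  rw [← subst_rename, subst_var]

theorem subst_closed (σ : Fin 0 → Term R O 0) (e : Term R O 0) : subst σ e = e := by
  rw [Subsingleton.elim σ var, subst_var]

/-- Substituting for the variable bound last amounts to extending the substitution. -/
theorem inst_subst_liftSub {n : ℕ} (σ : Fin n → Term R O 0) (e : Term R O (n + 1))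
    (v : Term R O 0) : (subst (liftSub σ) e).inst v = subst (extend σ v) e := by
  unfold inst
  rw [subst_subst]
  congr 1
  funext i
  cases i using Fin.cases with
  | zero => rfl
  | succ i => exact (subst_rename _ _ _).trans (subst_closed _ _)

theorem inst₂_subst_liftSub {n : ℕ} (σ : Fin n → Term R O 0) (e : Term R O (n + 2))
    (v w : Term R O 0) :
    (subst (liftSub (liftSub σ)) e).inst₂ v w = subst (extend (extend σ v) w) e := by
  unfold inst₂
  rw [subst_subst]
  congr 1
  funext i
  cases i using Fin.cases with
  | zero => rfl
  | succ i =>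
    cases i using Fin.cases with
    | zero => rfl
    | succ i =>
      exact (subst_rename _ _ _).trans ((subst_rename _ _ _).trans (subst_closed _ _))

/-- The substitution performed by `let_M x = ret v` does not affect a continuation that was
moved under the binder of `x`. -/
theorem subst_liftSub_rename_succ (v : Term R O 0) (g : Term R O 1) :
    subst (liftSub (fun _ : Fin 1 => v)) (rename (liftRen Fin.succ) g) = g := by
  rw [subst_rename, liftSub_comp_liftRen,
    Subsingleton.elim ((fun _ : Fin 1 => v) ∘ Fin.succ) var, liftSub_var, subst_var]

theorem IsValue.subst {m n : ℕ} {v : Term R O m} (hv : v.IsValue) {σ : Fin m → Term R O n}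
    (hσ : ∀ i, (σ i).IsValue) : (v.subst σ).IsValue := by
  induction hv with
  | var i => exact hσ i
  | star => exact .star
  | const k => exact .const k
  | apair _ _ ih ih' => exact .apair ih ih'
  | tpair _ _ ih ih' => exact .tpair ih ih'
  | inl _ ih => exact .inl ih
  | inr _ ih => exact .inr ih
  | lam e => exact .lam _
  | box _ ih => exact .box ih
  | ret _ ih => exact .ret ih

theorem IsValue.rename {m n : ℕ} {v : Term R O m} (hv : v.IsValue) (ξ : Fin m → Fin n) :
    (v.rename ξ).IsValue :=
  subst_var_comp ξ v ▸ hv.subst fun i => .var (ξ i)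

end Term

/-! ### Big-step evaluation -/

section Evaluation

variable {R : Type u} {S : Signature.{v}} {ε : ℝ≥0∞}

/-- Big-step evaluation of closed terms. Unlike `Step`, it is deterministic. The rule `ret`
makes every term `ret v` a result, even if `v` is not a value, since the reducts of an untyped
term include such terms. -/
inductive Eval (opFun : ∀ o : S.Op, ClosedValue R S ε (S.arg o) → R) (round : R → R) :
    Term R S.Op 0 → Term R S.Op 0 → Prop
  | val {v : Term R S.Op 0} (hv : v.IsValue) : Eval opFun round v v
  | ret (v : Term R S.Op 0) : Eval opFun round (.ret v) (.ret v)
  | op (o : S.Op) (v : Term R S.Op 0)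
      (hv : v.IsValue ∧ Nonempty (ClosedDeriv R S ε v (S.arg o))) :
      Eval opFun round (.op o v) (.const (opFun o ⟨v, hv⟩))
  | app {e : Term R S.Op 1} {v u : Term R S.Op 0} (hv : v.IsValue)
      (h : Eval opFun round (e.inst v) u) : Eval opFun round (.app (.lam e) v) u
  | fst {v w : Term R S.Op 0} (hv : v.IsValue) (hw : w.IsValue) :
      Eval opFun round (.fst (.apair v w)) v
  | snd {v w : Term R S.Op 0} (hv : v.IsValue) (hw : w.IsValue) :
      Eval opFun round (.snd (.apair v w)) w
  | letBox {v u : Term R S.Op 0} {e : Term R S.Op 1} (hv : v.IsValue)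
      (h : Eval opFun round (e.inst v) u) : Eval opFun round (.letBox (.box v) e) u
  | letPair {v w u : Term R S.Op 0} {e : Term R S.Op 2} (hv : v.IsValue) (hw : w.IsValue)
      (h : Eval opFun round (e.inst₂ v w) u) : Eval opFun round (.letPair (.tpair v w) e) u
  | caseInl {v u : Term R S.Op 0} {e f : Term R S.Op 1} (hv : v.IsValue)
      (h : Eval opFun round (e.inst v) u) : Eval opFun round (.case (.inl v) e f) u
  | caseInr {v u : Term R S.Op 0} {e f : Term R S.Op 1} (hv : v.IsValue)
      (h : Eval opFun round (f.inst v) u) : Eval opFun round (.case (.inr v) e f) u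
  | letIn {e v u : Term R S.Op 0} {f : Term R S.Op 1} (he : Eval opFun round e v)
      (hv : v.IsValue) (h : Eval opFun round (f.inst v) u) : Eval opFun round (.letIn e f) u
  | letM {e v u : Term R S.Op 0} {f : Term R S.Op 1} (he : Eval opFun round e (.ret v))
      (hv : v.IsValue) (h : Eval opFun round (f.inst v) u) : Eval opFun round (.letM e f) u
  | rnd (k : R) : Eval opFun round (.rnd (.const k)) (.ret (.const (round k)))

variable {opFun : ∀ o : S.Op, ClosedValue R S ε (S.arg o) → R} {round : R → R}

theorem Eval.eq_of_isValue {v u : Term R S.Op 0} (hv : v.IsValue) (h : Eval opFun round v u) :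
    u = v := by
  cases hv <;> cases h <;> rfl

theorem Eval.unique {e u u' : Term R S.Op 0} (h : Eval opFun round e u)
    (h' : Eval opFun round e u') : u = u' := by
  induction h generalizing u' with
  | val hv => exact (h'.eq_of_isValue hv).symm
  | ret v => cases h' <;> rfl
  | op o v hv =>
    cases h' with
    | val h => cases h
    | op => rfl
  | app hv _ ih =>
    cases h' with
    | val h => cases h
    | app _ h => exact ih h
  | fst hv hw =>
    cases h' with
    | val h => cases h
    | fst => rfl
  | snd hv hw =>
    cases h' with
    | val h => cases h
    | snd => rfl
  | letBox hv _ ih =>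
    cases h' with
    | val h => cases h
    | letBox _ h => exact ih h
  | letPair hv hw _ ih =>
    cases h' with
    | val h => cases h
    | letPair _ _ h => exact ih h
  | caseInl hv _ ih =>
    cases h' with
    | val h => cases h
    | caseInl _ h => exact ih h
  | caseInr hv _ ih =>
    cases h' with
    | val h => cases h
    | caseInr _ h => exact ih h
  | letIn _ hv _ ihe ih =>
    cases h' with
    | val h => cases h
    | letIn he _ h =>
      cases ihe he
      exact ih h
  | letM _ hv _ ihe ih =>
    cases h' with
    | val h => cases h
    | letM he _ h =>
      cases ihe he
      exact ih h
  | rnd k =>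
    cases h' with
    | val h => cases h
    | rnd => rfl

theorem Eval.steps {e u : Term R S.Op 0} (h : Eval opFun round e u) : Steps opFun round e u := by
  induction h with
  | val hv => exact .refl
  | ret v => exact .refl
  | op o v hv => exact .single (.op o ⟨v, hv⟩)
  | app hv _ ih => exact .head (.app _ hv) ih
  | fst hv hw => exact .single (.fst hv hw)
  | snd hv hw => exact .single (.snd hv hw)
  | letBox hv _ ih => exact .head (.letBox hv _) ih
  | letPair hv hw _ ih => exact .head (.letPair hv hw _) ih
  | caseInl hv _ ih => exact .head (.caseInl hv _ _) ih
  | caseInr hv _ ih => exact .head (.caseInr hv _ _) ih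
  | letIn _ hv _ ihe ih =>
    exact (Relation.ReflTransGen.lift (fun e => Term.letIn e _)
      (fun _ _ h => Step.letCongr _ h) _ _ ihe).trans (.head (.letVal hv _) ih)
  | letM _ hv _ ihe ih =>
    exact (Relation.ReflTransGen.lift (fun e => Term.letM e _)
      (fun _ _ h => Step.letMCongr _ h) _ _ ihe).trans (.head (.letRet hv _) ih)
  | rnd k => exact .single (.rnd k)

/-- Evaluation is closed under expansion. The step relation is not deterministic, as a redex of
`letAssoc` may also step inside its first component; this lemma takes the place of a confluence
proof. -/
theorem Step.eval {e e' u : Term R S.Op 0} (h : Step opFun round e e')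
    (h' : Eval opFun round e' u) : Eval opFun round e u := by
  induction h generalizing u with
  | op o v =>
    cases h'.eq_of_isValue (.const _)
    exact .op o v.1 v.2
  | app e hv => exact .app hv h'
  | fst hv hw =>
    cases h'.eq_of_isValue hv
    exact .fst hv hw
  | snd hv hw =>
    cases h'.eq_of_isValue hw
    exact .snd hv hw
  | letBox hv e => exact .letBox hv h'
  | letRet hv f => exact .letM (.ret _) hv h'
  | letPair hv hw e => exact .letPair hv hw h'
  | caseInl hv e f => exact .caseInl hv h'
  | caseInr hv e f => exact .caseInr hv h'
  | letVal hv f => exact .letIn (.val hv) hv h'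
  | letAssoc hv f g =>
    cases h' with
    | val h => cases h
    | letM he hw h =>
      rw [Term.inst, Term.subst, Term.subst_liftSub_rename_succ] at h
      cases h with
      | val h => cases h
      | letM hf hz hg => exact .letM (.letM he hw hf) hz hg
  | rnd k =>
    cases h'.eq_of_isValue (.ret (.const _))
    exact .rnd k
  | letCongr f _ ih =>
    cases h' with
    | val h => cases h
    | letIn he hv h => exact .letIn (ih he) hv h
  | letMCongr f _ ih =>
    cases h' with
    | val h => cases h
    | letM he hv h => exact .letM (ih he) hv h

theorem Steps.eval_ret {e v : Term R S.Op 0} (h : Steps opFun round e (.ret v)) :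
    Eval opFun round e (.ret v) := by
  induction h using Relation.ReflTransGen.head_induction_on with
  | refl => exact .ret v
  | head h _ ih => exact h.eval ih

end Evaluation

/-! ### Substitution in typing derivations -/

section Typing

variable {R : Type u} [PseudoEMetricSpace R] {S : Signature.{v}} {ε : ℝ≥0∞} {ρ : R → R}

theorem Met.Hom.ext {A B : Met.{u}} {f g : Met.Hom A B} (h : ∀ a, f a = g a) : f = g := by
  cases f
  cases g
  congr 1
  exact funext h

/-- The term `e` has a derivation of `Γ ⊢ e : τ`, with grades `γ`, that denotes the map `f`. -/
def HasDen (ρ : R → R) (hρ : ∀ x, edist x (ρ x) ≤ ε)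
    (opDen : ∀ o : S.Op, Met.Hom ((S.arg o).den (Met.of R)) (Met.of R))
    {n : ℕ} (Γ : Fin n → Ty) (γ : Fin n → ℝ≥0∞) (e : Term R S.Op n) (τ : Ty)
    (f : Env (Met.of R) Γ → τ.den (Met.of R)) : Prop :=
  ∃ D : Deriv R S ε Γ γ e τ, ∀ h, denote ρ hρ opDen D h = f h

/-- The grades of `e[σ]`, where `γ` are the grades of `e` and `M i` those of `σ i`. -/
noncomputable def pushGrade {m n : ℕ} (M : Fin m → Fin n → ℝ≥0∞) (γ : Fin m → ℝ≥0∞) :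
    Fin n → ℝ≥0∞ :=
  fun j => ∑ i, γ i * M i j

theorem pushGrade_add {m n : ℕ} (M : Fin m → Fin n → ℝ≥0∞) (γ θ : Fin m → ℝ≥0∞) (j : Fin n) :
    pushGrade M (fun i => γ i + θ i) j = pushGrade M γ j + pushGrade M θ j := by
  simp only [pushGrade, add_mul, Finset.sum_add_distrib]

theorem pushGrade_smul {m n : ℕ} (M : Fin m → Fin n → ℝ≥0∞) (s : ℝ≥0∞) (γ : Fin m → ℝ≥0∞)
    (j : Fin n) : pushGrade M (fun i => s * γ i) j = s * pushGrade M γ j := by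
  simp only [pushGrade, mul_assoc, Finset.mul_sum]

theorem pushGrade_mono {m n : ℕ} (M : Fin m → Fin n → ℝ≥0∞) {γ θ : Fin m → ℝ≥0∞}
    (h : ∀ i, γ i ≤ θ i) (j : Fin n) : pushGrade M γ j ≤ pushGrade M θ j :=
  Finset.sum_le_sum fun i _ => mul_le_mul_left (h i) _

theorem le_pushGrade {m n : ℕ} (M : Fin m → Fin n → ℝ≥0∞) {γ : Fin m → ℝ≥0∞} {i : Fin m}
    (h : 1 ≤ γ i) (j : Fin n) : M i j ≤ pushGrade M γ j :=
  (le_mul_of_one_le_left zero_le h).trans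
    (Finset.single_le_sum (f := fun i => γ i * M i j) (fun _ _ => zero_le) (Finset.mem_univ i))

/-- The grades of a substitution extended under a binder: the new variable is mapped to itself. -/
noncomputable def liftGrade {m n : ℕ} (M : Fin m → Fin n → ℝ≥0∞) :
    Fin (m + 1) → Fin (n + 1) → ℝ≥0∞ :=
  extend (fun i => extend (M i) 0) (extend 0 1)

theorem pushGrade_liftGrade {m n : ℕ} (M : Fin m → Fin n → ℝ≥0∞) (γ : Fin m → ℝ≥0∞)
    (s : ℝ≥0∞) : pushGrade (liftGrade M) (extend γ s) = extend (pushGrade M γ) s := by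
  funext j
  unfold pushGrade
  rw [Fin.sum_univ_succ]
  cases j using Fin.cases <;> simp [liftGrade, extend]

theorem extend_le_extend {n : ℕ} {γ θ : Fin n → ℝ≥0∞} (h : ∀ i, γ i ≤ θ i) (s : ℝ≥0∞)
    (i : Fin (n + 1)) : extend γ s i ≤ extend θ s i := by
  cases i using Fin.cases with
  | zero => exact le_rfl
  | succ i => exact h i

/-- In the grades of a rule with two premises, an excess can be assigned to the second premise.
The maximum is needed because `δ - γ` is `0` if `γ` and `δ` are infinite. -/
theorem exists_add_eq {n : ℕ} {γ θ δ : Fin n → ℝ≥0∞} (h : ∀ i, γ i + θ i ≤ δ i) :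
    ∃ θ' : Fin n → ℝ≥0∞, (∀ i, θ i ≤ θ' i) ∧ δ = fun i => γ i + θ' i := by
  refine ⟨fun i => max (θ i) (δ i - γ i), fun i => le_max_left _ _, funext fun i => ?_⟩
  rw [add_max, add_tsub_cancel_of_le (le_self_add.trans (h i)), max_eq_right (h i)]

/-- A kind of entries that typed substitutions may have: `K Δ μ t A a` says that `t` is such an
entry, of type `A` in the environment `Δ` with grades `μ`, and denotes `a`. The substitution
lemma is proved once for all kinds; the kind of variables gives renaming and weakening, which
show that the values form a kind. -/
structure IsKind (ρ : R → R) (hρ : ∀ x, edist x (ρ x) ≤ ε)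
    (opDen : ∀ o : S.Op, Met.Hom ((S.arg o).den (Met.of R)) (Met.of R))
    (K : ∀ {n : ℕ} (Δ : Fin n → Ty), (Fin n → ℝ≥0∞) → Term R S.Op n → (A : Ty) →
      (Env (Met.of R) Δ → A.den (Met.of R)) → Prop) : Prop where
  isValue : ∀ {n : ℕ} {Δ : Fin n → Ty} {μ t A a}, K Δ μ t A a → t.IsValue
  hasDen : ∀ {n : ℕ} {Δ : Fin n → Ty} {μ t A a}, K Δ μ t A a → HasDen ρ hρ opDen Δ μ t A a
  mono : ∀ {n : ℕ} {Δ : Fin n → Ty} {μ μ' : Fin n → ℝ≥0∞} {t A a}, (∀ i, μ i ≤ μ' i) →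
    K Δ μ t A a → K Δ μ' t A a
  zero : ∀ {n : ℕ} {Δ : Fin n → Ty} {A : Ty},
    K (extend Δ A) (extend 0 1) (.var 0) A (fun h => h 0)
  succ : ∀ {n : ℕ} {Δ : Fin n → Ty} {μ t A a} {B : Ty}, K Δ μ t A a →
    K (extend Δ B) (extend μ 0) (t.rename Fin.succ) A (fun h => a (fun i => h i.succ))

variable {hρ : ∀ x, edist x (ρ x) ≤ ε}
  {opDen : ∀ o : S.Op, Met.Hom ((S.arg o).den (Met.of R)) (Met.of R)}
  {K : ∀ {n : ℕ} (Δ : Fin n → Ty), (Fin n → ℝ≥0∞) → Term R S.Op n → (A : Ty) →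
      (Env (Met.of R) Δ → A.den (Met.of R)) → Prop}

theorem IsKind.lift (hK : IsKind ρ hρ opDen K) {m n : ℕ} {Γ : Fin m → Ty} {Δ : Fin n → Ty}
    {σ : Fin m → Term R S.Op n} {M : Fin m → Fin n → ℝ≥0∞}
    {φ : Env (Met.of R) Δ → Env (Met.of R) Γ}
    (hσ : ∀ i, K Δ (M i) (σ i) (Γ i) (fun h => φ h i)) (B : Ty) (i : Fin (m + 1)) :
    K (extend Δ B) (liftGrade M i) (Term.liftSub σ i) (extend Γ B i)
      (fun h => consEnv (σ := B) (φ fun i => h i.succ) (h 0) i) := by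
  cases i using Fin.cases with
  | zero => exact hK.zero
  | succ i => exact hK.succ (hσ i)

/-- Substitution, weakening included: if `σ` maps the variables of `e` to terms with grades `M`
that denote the components of `φ`, then `e[σ]` denotes the composition of `⟦e⟧` with `φ`. -/
theorem IsKind.hasDen_subst (hK : IsKind ρ hρ opDen K) {m n : ℕ} {Γ : Fin m → Ty}
    {γ : Fin m → ℝ≥0∞} {e : Term R S.Op m} {τ : Ty} (D : Deriv R S ε Γ γ e τ)
    {Δ : Fin n → Ty} {δ : Fin n → ℝ≥0∞} {σ : Fin m → Term R S.Op n}
    {M : Fin m → Fin n → ℝ≥0∞} {φ : Env (Met.of R) Δ → Env (Met.of R) Γ}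
    (hσ : ∀ i, K Δ (M i) (σ i) (Γ i) (fun h => φ h i)) (hδ : ∀ j, pushGrade M γ j ≤ δ j) :
    HasDen ρ hρ opDen Δ δ (e.subst σ) τ (fun h => denote ρ hρ opDen D (φ h)) := by
  have hv {m n : ℕ} {Γ : Fin m → Ty} {Δ : Fin n → Ty} {σ : Fin m → Term R S.Op n}
      {M : Fin m → Fin n → ℝ≥0∞} {φ : Env (Met.of R) Δ → Env (Met.of R) Γ}
      (hσ : ∀ i, K Δ (M i) (σ i) (Γ i) (fun h => φ h i)) {v : Term R S.Op m} (hv : v.IsValue) :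
      (v.subst σ).IsValue := hv.subst fun i => hK.isValue (hσ i)
  have hext {m n : ℕ} {M : Fin m → Fin n → ℝ≥0∞} {θ : Fin m → ℝ≥0∞} {θ' : Fin n → ℝ≥0∞}
      (h : ∀ j, pushGrade M θ j ≤ θ' j) (s : ℝ≥0∞) (j : Fin (n + 1)) :
      pushGrade (liftGrade M) (extend θ s) j ≤ extend θ' s j := by
    rw [pushGrade_liftGrade]
    exact extend_le_extend h s j
  induction D generalizing n with
  | unit => exact ⟨.unit, fun _ => rfl⟩
  | const k => exact ⟨.const k, fun _ => rfl⟩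
  | var i hi =>
    exact hK.hasDen (hK.mono (fun j => (le_pushGrade M hi j).trans (hδ j)) (hσ i))
  | lam De ih =>
    obtain ⟨De', he⟩ := ih (hK.lift hσ _) (hext hδ 1)
    exact ⟨.lam De', fun h => Met.Hom.ext fun a => he (consEnv h a)⟩
  | app hv₁ hv₂ Dv Dw ihv ihw =>
    obtain ⟨θ', hθ, rfl⟩ := exists_add_eq fun j => (pushGrade_add M _ _ j).ge.trans (hδ j)
    obtain ⟨Dv', h₁⟩ := ihv hσ fun _ => le_rfl
    obtain ⟨Dw', h₂⟩ := ihw hσ hθ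
    refine ⟨.app (hv hσ hv₁) (hv hσ hv₂) Dv' Dw', fun h => ?_⟩
    simp only [denote, appHom, h₁, h₂]
  | apair hv₁ hv₂ Dv Dw ihv ihw =>
    obtain ⟨Dv', h₁⟩ := ihv hσ hδ
    obtain ⟨Dw', h₂⟩ := ihw hσ hδ
    exact ⟨.apair (hv hσ hv₁) (hv hσ hv₂) Dv' Dw', fun h => congrArg₂ Prod.mk (h₁ h) (h₂ h)⟩
  | fst hv₁ Dv ih =>
    obtain ⟨Dv', h₁⟩ := ih hσ hδ
    exact ⟨.fst (hv hσ hv₁) Dv', fun h => congrArg fstHom.toFun (h₁ h)⟩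
  | snd hv₁ Dv ih =>
    obtain ⟨Dv', h₁⟩ := ih hσ hδ
    exact ⟨.snd (hv hσ hv₁) Dv', fun h => congrArg sndHom.toFun (h₁ h)⟩
  | tpair hv₁ hv₂ Dv Dw ihv ihw =>
    obtain ⟨θ', hθ, rfl⟩ := exists_add_eq fun j => (pushGrade_add M _ _ j).ge.trans (hδ j)
    obtain ⟨Dv', h₁⟩ := ihv hσ fun _ => le_rfl
    obtain ⟨Dw', h₂⟩ := ihw hσ hθ
    exact ⟨.tpair (hv hσ hv₁) (hv hσ hv₂) Dv' Dw', fun h => congrArg₂ Prod.mk (h₁ h) (h₂ h)⟩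
  | letPair hv₁ Dv De ihv ihe =>
    obtain ⟨θ', hθ, rfl⟩ := exists_add_eq fun j =>
      (((pushGrade_add M _ _ j).trans (by rw [pushGrade_smul])).ge.trans (hδ j))
    obtain ⟨Dv', h₁⟩ := ihv hσ fun _ => le_rfl
    obtain ⟨De', h₂⟩ := ihe (hK.lift (hK.lift hσ _) _) (hext (hext hθ _) _)
    refine ⟨.letPair (hv hσ hv₁) Dv' De', fun h => (h₂ _).trans ?_⟩
    simp only [denote, letPairHom, h₁]
    rfl
  | inl hv₁ Dv ih =>
    obtain ⟨Dv', h₁⟩ := ih hσ hδ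
    exact ⟨.inl (hv hσ hv₁) Dv', fun h => congrArg Sum.inl (h₁ h)⟩
  | inr hv₁ Dv ih =>
    obtain ⟨Dv', h₁⟩ := ih hσ hδ
    exact ⟨.inr (hv hσ hv₁) Dv', fun h => congrArg Sum.inr (h₁ h)⟩
  | case hs hv₁ Dv De Df ihv ihe ihf =>
    obtain ⟨θ', hθ, rfl⟩ := exists_add_eq fun j =>
      (((pushGrade_add M _ _ j).trans (by rw [pushGrade_smul])).ge.trans (hδ j))
    obtain ⟨Dv', h₁⟩ := ihv hσ fun _ => le_rfl
    obtain ⟨De', h₂⟩ := ihe (hK.lift hσ _) (hext hθ _)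
    obtain ⟨Df', h₃⟩ := ihf (hK.lift hσ _) (hext hθ _)
    refine ⟨.case hs (hv hσ hv₁) Dv' De' Df', fun h => ?_⟩
    simp only [denote, caseHom, h₁]
    generalize denote ρ hρ opDen Dv (φ h) = x
    rcases x with a | b
    · exact h₂ _
    · exact h₃ _
  | box hγ hv₁ Dv ih =>
    obtain ⟨Dv', h₁⟩ := ih hσ fun _ => le_rfl
    exact ⟨.box (fun j => (pushGrade_smul M _ _ j).ge.trans
      ((pushGrade_mono M hγ j).trans (hδ j))) (hv hσ hv₁) Dv', fun h => by
        simp only [denote, boxHom, h₁]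
        rfl⟩
  | letBox hv₁ Dv De ihv ihe =>
    obtain ⟨θ', hθ, rfl⟩ := exists_add_eq fun j =>
      (((pushGrade_add M _ _ j).trans (by rw [pushGrade_smul])).ge.trans (hδ j))
    obtain ⟨Dv', h₁⟩ := ihv hσ fun _ => le_rfl
    obtain ⟨De', h₂⟩ := ihe (hK.lift hσ _) (hext hθ _)
    refine ⟨.letBox (hv hσ hv₁) Dv' De', fun h => (h₂ _).trans ?_⟩
    simp only [denote, letBoxHom, h₁]
    rfl
  | letIn hs De Df ihe ihf =>
    obtain ⟨θ', hθ, rfl⟩ := exists_add_eq fun j =>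
      (((pushGrade_add M _ _ j).trans (by rw [pushGrade_smul])).ge.trans (hδ j))
    obtain ⟨De', h₁⟩ := ihe hσ fun _ => le_rfl
    obtain ⟨Df', h₂⟩ := ihf (hK.lift hσ _) (hext hθ _)
    refine ⟨.letIn hs De' Df', fun h => (h₂ _).trans ?_⟩
    simp only [denote, letInHom, h₁]
    rfl
  | ret hv₁ Dv ih =>
    obtain ⟨Dv', h₁⟩ := ih hσ hδ
    exact ⟨.ret (hv hσ hv₁) Dv', fun h => congrArg retHom.toFun (h₁ h)⟩
  | rnd hv₁ Dv ih =>
    obtain ⟨Dv', h₁⟩ := ih hσ hδ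
    exact ⟨.rnd (hv hσ hv₁) Dv', fun h => congrArg (rndHom (A := Met.of R) ρ hρ).toFun (h₁ h)⟩
  | msub hqr De ih =>
    obtain ⟨De', h₁⟩ := ih hσ hδ
    exact ⟨.msub hqr De', fun h => congrArg (msubHom hqr).toFun (h₁ h)⟩
  | letM De Df ihe ihf =>
    obtain ⟨θ', hθ, rfl⟩ := exists_add_eq fun j =>
      (((pushGrade_add M _ _ j).trans (by rw [pushGrade_smul])).ge.trans (hδ j))
    obtain ⟨De', h₁⟩ := ihe hσ fun _ => le_rfl
    obtain ⟨Df', h₂⟩ := ihf (hK.lift hσ _) (hext hθ _)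
    refine ⟨.letM De' Df', fun h => Subtype.ext ?_⟩
    simp only [denote, letMHom, h₁, h₂]
    rfl
  | op o hv₁ Dv ih =>
    obtain ⟨Dv', h₁⟩ := ih hσ hδ
    exact ⟨.op o (hv hσ hv₁) Dv', fun h => congrArg (opDen o).toFun (h₁ h)⟩

/-- The kind of variables. -/
inductive VarKind {n : ℕ} (Δ : Fin n → Ty) (μ : Fin n → ℝ≥0∞) :
    Term R S.Op n → (A : Ty) → (Env (Met.of R) Δ → A.den (Met.of R)) → Prop
  | mk (j : Fin n) (hj : 1 ≤ μ j) : VarKind Δ μ (.var j) (Δ j) (fun h => h j)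

theorem isKind_varKind : IsKind ρ hρ opDen VarKind where
  isValue := by rintro _ _ _ _ _ _ ⟨j, hj⟩; exact .var j
  hasDen := by rintro _ _ _ _ _ _ ⟨j, hj⟩; exact ⟨.var j hj, fun _ => rfl⟩
  mono := by rintro _ _ _ _ _ _ _ h ⟨j, hj⟩; exact .mk j (hj.trans (h j))
  zero := .mk (Δ := extend _ _) 0 le_rfl
  succ := by rintro _ Δ μ _ _ _ B ⟨j, hj⟩; exact .mk (Δ := extend Δ B) (μ := extend μ 0) j.succ hj

theorem HasDen.mono {n : ℕ} {Δ : Fin n → Ty} {μ μ' : Fin n → ℝ≥0∞} {t : Term R S.Op n} {A : Ty}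
    {a : Env (Met.of R) Δ → A.den (Met.of R)} (hμ : ∀ i, μ i ≤ μ' i)
    (h : HasDen ρ hρ opDen Δ μ t A a) : HasDen ρ hρ opDen Δ μ' t A a := by
  obtain ⟨D, hD⟩ := h
  obtain rfl : (fun h => denote ρ hρ opDen D h) = a := funext hD
  have := isKind_varKind.hasDen_subst (hρ := hρ) (opDen := opDen) D (σ := .var) (δ := μ') (φ := id)
    (M := fun i => Pi.single i 1) (fun i => .mk i (by simp)) fun j => by
      simpa [pushGrade, Pi.single_apply] using hμ j
  rwa [Term.subst_var] at this

theorem HasDen.rename_succ {n : ℕ} {Δ : Fin n → Ty} {μ : Fin n → ℝ≥0∞} {t : Term R S.Op n}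
    {A : Ty} {a : Env (Met.of R) Δ → A.den (Met.of R)} (h : HasDen ρ hρ opDen Δ μ t A a)
    (B : Ty) : HasDen ρ hρ opDen (extend Δ B) (extend μ 0) (t.rename Fin.succ) A
      (fun h => a (fun i => h i.succ)) := by
  obtain ⟨D, hD⟩ := h
  obtain rfl : (fun h => denote ρ hρ opDen D h) = a := funext hD
  have := isKind_varKind.hasDen_subst (hρ := hρ) (opDen := opDen) D (σ := .var ∘ Fin.succ)
    (Δ := extend Δ B) (δ := extend μ 0) (φ := fun h i => h i.succ)
    (M := fun i => Pi.single i.succ 1)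
    (fun i => .mk (Δ := extend Δ B) i.succ (by simp)) fun j => by
      cases j using Fin.cases <;> simp [pushGrade, Pi.single_apply, extend]
  rwa [Term.subst_var_comp] at this

theorem isKind_value : IsKind ρ hρ opDen (fun {_} (Δ : Fin _ → Ty) μ t A a =>
    t.IsValue ∧ HasDen ρ hρ opDen Δ μ t A a) where
  isValue h := h.1
  hasDen h := h.2
  mono h h' := ⟨h'.1, h'.2.mono h⟩
  zero := ⟨.var _, .var (Γ := extend _ _) 0 le_rfl, fun _ => rfl⟩
  succ h := ⟨h.1.rename _, h.2.rename_succ _⟩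

/-- Substitution of closed values for all variables. The grades of the empty environment are
irrelevant. -/
theorem hasDen_subst_closed {n : ℕ} {Γ : Fin n → Ty} {γ : Fin n → ℝ≥0∞} {e : Term R S.Op n}
    {τ : Ty} (D : Deriv R S ε Γ γ e τ) {σ : Fin n → Term R S.Op 0} (hσ : ∀ i, (σ i).IsValue)
    (Dσ : ∀ i, ClosedDeriv R S ε (σ i) (Γ i)) :
    ∃ D' : ClosedDeriv R S ε (e.subst σ) τ, denoteClosed ρ hρ opDen D' =
      denote ρ hρ opDen D (fun i => denoteClosed ρ hρ opDen (Dσ i)) := by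
  obtain ⟨D', h⟩ := isKind_value.hasDen_subst (hρ := hρ) (opDen := opDen) D (σ := σ)
    (Δ := ![]) (δ := ![]) (M := fun _ => ![])
    (φ := fun _ i => denoteClosed ρ hρ opDen (Dσ i))
    (fun i => ⟨hσ i, Dσ i, fun h => congrArg _ (Subsingleton.elim _ _)⟩) (fun j => j.elim0)
  exact ⟨D', h _⟩

end Typing

/-! ### The two components of the neighborhood monad -/

/-- The first component of a pair in the ideal semantics (`false`), and the second one in the
floating-point semantics (`true`). -/
def sel {A : Type u} : Bool → A × A → A
  | false, p => p.1
  | true, p => p.2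

/-- The rounding function of the ideal (`false`) or floating-point (`true`) semantics. -/
def roundOf {R : Type u} (ρ : R → R) : Bool → R → R
  | false => id
  | true => ρ

/-- Points that the semantics `m` cannot distinguish: on `M_q τ`, only the component selected
by `m` is compared. -/
def Agree (N : Met.{u}) (m : Bool) : (τ : Ty) → τ.den N → τ.den N → Prop
  | .unit, _, _ => True
  | .num, a, b => a = b
  | .amp σ τ, a, b => Agree N m σ a.1 b.1 ∧ Agree N m τ a.2 b.2
  | .tensor σ τ, a, b => Agree N m σ a.1 b.1 ∧ Agree N m τ a.2 b.2
  | .sum σ τ, a, b => Sum.LiftRel (Agree N m σ) (Agree N m τ) a b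
  | .lolli σ τ, f, g => ∀ a b, Agree N m σ a b →
      Agree N m τ (Met.Hom.toFun f a) (Met.Hom.toFun g b)
  | .bang _ σ, a, b => Agree N m σ a b
  | .mon _ τ, a, b => Agree N m τ (sel m a.1) (sel m b.1)

/-- On types without `M`, points that agree are equal. This is what allows the non-expansive
maps `opDen` to be applied in the presence of variables of monadic type. -/
theorem agree_iff_eq {N : Met.{u}} {m : Bool} {τ : Ty} (hτ : τ.MonadFree) {a b : τ.den N} :
    Agree N m τ a b ↔ a = b := by
  induction τ with
  | unit => exact ⟨fun _ => rfl, fun _ => trivial⟩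
  | num => exact Iff.rfl
  | amp σ τ ih ih' => exact (and_congr (ih hτ.1) (ih' hτ.2)).trans Prod.ext_iff.symm
  | tensor σ τ ih ih' => exact (and_congr (ih hτ.1) (ih' hτ.2)).trans Prod.ext_iff.symm
  | sum σ τ ih ih' =>
    constructor
    · intro h
      cases h with
      | inl h => exact congrArg Sum.inl ((ih hτ.1).1 h)
      | inr h => exact congrArg Sum.inr ((ih' hτ.2).1 h)
    · rintro rfl
      rcases a with a | a
      · exact .inl ((ih hτ.1).2 rfl)
      · exact .inr ((ih' hτ.2).2 rfl)
  | lolli σ τ ih ih' =>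
    constructor
    · exact fun h => Met.Hom.ext fun x => (ih' hτ.2).1 (h x x ((ih hτ.1).2 rfl))
    · rintro rfl x y h
      obtain rfl := (ih hτ.1).1 h
      exact (ih' hτ.2).2 rfl
  | bang s σ ih => exact ih hτ
  | mon q τ => exact hτ.elim

section Soundness

variable {R : Type u} [PseudoEMetricSpace R] {S : Signature.{v}} {ε : ℝ≥0∞} {ρ : R → R}
  {hρ : ∀ x, edist x (ρ x) ≤ ε}
  {opDen : ∀ o : S.Op, Met.Hom ((S.arg o).den (Met.of R)) (Met.of R)}

theorem Agree.cons {m : Bool} {n : ℕ} {Γ : Fin n → Ty} {g h : Env (Met.of R) Γ}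
    (hgh : ∀ i, Agree _ m (Γ i) (g i) (h i)) {σ : Ty} {a b : σ.den (Met.of R)}
    (hab : Agree _ m σ a b) (i : Fin (n + 1)) :
    Agree _ m (extend Γ σ i) (consEnv g a i) (consEnv h b i) := by
  cases i using Fin.cases with
  | zero => exact hab
  | succ i => exact hgh i

/-- Denotations preserve agreement: the component of a result of monadic type selected by `m`
depends only on the components selected by `m` in the environment. -/
theorem agree_denote (hS : ∀ o : S.Op, (S.arg o).MonadFree) (m : Bool) {n : ℕ}
    {Γ : Fin n → Ty} {γ : Fin n → ℝ≥0∞} {e : Term R S.Op n} {τ : Ty} (D : Deriv R S ε Γ γ e τ)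
    {g h : Env (Met.of R) Γ} (hgh : ∀ i, Agree _ m (Γ i) (g i) (h i)) :
    Agree _ m τ (denote ρ hρ opDen D g) (denote ρ hρ opDen D h) := by
  induction D with
  | unit => trivial
  | const k => rfl
  | var i hi => exact hgh i
  | lam De ih => exact fun a b hab => ih (Agree.cons hgh hab)
  | app _ _ Dv Dw ihv ihw => exact ihv hgh _ _ (ihw hgh)
  | apair _ _ Dv Dw ihv ihw => exact ⟨ihv hgh, ihw hgh⟩
  | fst _ Dv ih => exact (ih hgh).1
  | snd _ Dv ih => exact (ih hgh).2
  | tpair _ _ Dv Dw ihv ihw => exact ⟨ihv hgh, ihw hgh⟩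
  | letPair _ Dv De ihv ihe => exact ihe (Agree.cons (Agree.cons hgh (ihv hgh).1) (ihv hgh).2)
  | inl _ Dv ih => exact .inl (ih hgh)
  | inr _ Dv ih => exact .inr (ih hgh)
  | case hs _ Dv De Df ihv ihe ihf =>
    have hv := ihv hgh
    simp only [denote, caseHom]
    revert hv
    generalize denote ρ hρ opDen Dv g = x
    generalize denote ρ hρ opDen Dv h = y
    rintro (⟨hab⟩ | ⟨hab⟩)
    · exact ihe (Agree.cons hgh hab)
    · exact ihf (Agree.cons hgh hab)
  | box _ _ Dv ih => exact ih hgh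
  | letBox _ Dv De ihv ihe => exact ihe (Agree.cons hgh (ihv hgh))
  | letIn _ De Df ihe ihf => exact ihf (Agree.cons hgh (ihe hgh))
  | ret _ Dv ih => cases m <;> exact ih hgh
  | rnd _ Dv ih =>
    have h := ih hgh
    cases m
    · exact h
    · exact congrArg ρ h
  | msub _ De ih => exact ih hgh
  | letM De Df ihe ihf =>
    have h := ihf (Agree.cons hgh (ihe hgh))
    cases m <;> exact h
  | op o _ Dv ih => exact congrArg (opDen o).toFun ((agree_iff_eq (hS o)).1 (ih hgh))

/-! ### Computability of closed terms -/

variable {opFun : ∀ o : S.Op, ClosedValue R S ε (S.arg o) → R}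

/-- The closed value `v` has type `τ`, and its denotation agrees with `a`. -/
def TypedBy (ρ : R → R) (hρ : ∀ x, edist x (ρ x) ≤ ε)
    (opDen : ∀ o : S.Op, Met.Hom ((S.arg o).den (Met.of R)) (Met.of R)) (m : Bool)
    (τ : Ty) (v : Term R S.Op 0) (a : τ.den (Met.of R)) : Prop :=
  v.IsValue ∧ ∃ D : ClosedDeriv R S ε v τ, Agree _ m τ (denoteClosed ρ hρ opDen D) a

/-- The logical relation between closed values and points: `v` implements `a` under the
semantics `m`. -/
def Comp (ρ : R → R) (hρ : ∀ x, edist x (ρ x) ≤ ε)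
    (opDen : ∀ o : S.Op, Met.Hom ((S.arg o).den (Met.of R)) (Met.of R))
    (opFun : ∀ o : S.Op, ClosedValue R S ε (S.arg o) → R) (m : Bool) :
    (τ : Ty) → Term R S.Op 0 → τ.den (Met.of R) → Prop
  | .unit, v, a => TypedBy ρ hρ opDen m .unit v a
  | .num, v, a => TypedBy ρ hρ opDen m .num v a ∧ v = .const a
  | .amp σ τ, v, a => TypedBy ρ hρ opDen m (.amp σ τ) v a ∧ ∃ v₁ v₂, v = .apair v₁ v₂ ∧
      Comp ρ hρ opDen opFun m σ v₁ a.1 ∧ Comp ρ hρ opDen opFun m τ v₂ a.2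
  | .tensor σ τ, v, a => TypedBy ρ hρ opDen m (.tensor σ τ) v a ∧ ∃ v₁ v₂, v = .tpair v₁ v₂ ∧
      Comp ρ hρ opDen opFun m σ v₁ a.1 ∧ Comp ρ hρ opDen opFun m τ v₂ a.2
  | .sum σ τ, v, a => TypedBy ρ hρ opDen m (.sum σ τ) v a ∧
      ((∃ v' a', v = .inl v' ∧ a = Sum.inl a' ∧ Comp ρ hρ opDen opFun m σ v' a') ∨
        ∃ v' a', v = .inr v' ∧ a = Sum.inr a' ∧ Comp ρ hρ opDen opFun m τ v' a')
  | .lolli σ τ, v, a => TypedBy ρ hρ opDen m (.lolli σ τ) v a ∧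
      ∀ w b, Comp ρ hρ opDen opFun m σ w b →
        ∃ u, Eval opFun (roundOf ρ m) (.app v w) u ∧
          Comp ρ hρ opDen opFun m τ u (Met.Hom.toFun a b)
  | .bang s σ, v, a => TypedBy ρ hρ opDen m (.bang s σ) v a ∧
      ∃ v', v = .box v' ∧ Comp ρ hρ opDen opFun m σ v' a
  | .mon q τ, v, a => TypedBy ρ hρ opDen m (.mon q τ) v a ∧
      ∃ v', v = .ret v' ∧ Comp ρ hρ opDen opFun m τ v' (sel m a.1)

theorem Comp.typedBy {m : Bool} {τ : Ty} {v : Term R S.Op 0} {a : τ.den (Met.of R)}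
    (h : Comp ρ hρ opDen opFun m τ v a) : TypedBy ρ hρ opDen m τ v a := by
  cases τ with
  | unit => exact h
  | _ => exact h.1

theorem Comp.cons {m : Bool} {n : ℕ} {Γ : Fin n → Ty} {w : Fin n → Term R S.Op 0}
    {g : Env (Met.of R) Γ} (hw : ∀ i, Comp ρ hρ opDen opFun m (Γ i) (w i) (g i)) {σ : Ty}
    {v : Term R S.Op 0} {a : σ.den (Met.of R)} (hv : Comp ρ hρ opDen opFun m σ v a)
    (i : Fin (n + 1)) :
    Comp ρ hρ opDen opFun m (extend Γ σ i) (extend w v i) (consEnv g a i) := by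
  cases i using Fin.cases with
  | zero => exact hv
  | succ i => exact hw i

/-- Subsumption for results of monadic type: the grade bounds the distance of the two components,
and does not otherwise matter. -/
theorem Comp.mon_mono {m : Bool} {τ : Ty} {q r : ℝ≥0∞} (hqr : q ≤ r) {u : Term R S.Op 0}
    {a : (Ty.mon q τ).den (Met.of R)} {b : (Ty.mon r τ).den (Met.of R)}
    (hab : sel m a.1 = sel m b.1) (h : Comp ρ hρ opDen opFun m (.mon q τ) u a) :
    Comp ρ hρ opDen opFun m (.mon r τ) u b := by
  obtain ⟨⟨hu, D, hD⟩, v, rfl, hv⟩ := h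
  refine ⟨⟨hu, .msub hqr D, ?_⟩, v, rfl, hab ▸ hv⟩
  change Agree _ m τ _ (sel m b.1)
  rw [← hab]
  exact hD

/-- The fundamental lemma: under a substitution of closed values that implement `g`, a term
evaluates to a value that implements its denotation at `g`. -/
theorem exists_eval_comp (hS : ∀ o : S.Op, (S.arg o).MonadFree)
    (hop : ∀ (o : S.Op) (v : ClosedValue R S ε (S.arg o))
      (D : ClosedDeriv R S ε v.1 (S.arg o)), opDen o (denoteClosed ρ hρ opDen D) = opFun o v)
    (m : Bool) {n : ℕ} {Γ : Fin n → Ty} {γ : Fin n → ℝ≥0∞} {e : Term R S.Op n} {τ : Ty}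
    (D : Deriv R S ε Γ γ e τ) {w : Fin n → Term R S.Op 0} {g : Env (Met.of R) Γ}
    (hw : ∀ i, Comp ρ hρ opDen opFun m (Γ i) (w i) (g i)) :
    ∃ u, Eval opFun (roundOf ρ m) (e.subst w) u ∧
      Comp ρ hρ opDen opFun m τ u (denote ρ hρ opDen D g) := by
  have hval {n : ℕ} {Γ : Fin n → Ty} {w : Fin n → Term R S.Op 0} {g : Env (Met.of R) Γ}
      (hw : ∀ i, Comp ρ hρ opDen opFun m (Γ i) (w i) (g i)) {v : Term R S.Op n}
      (hv : v.IsValue) : (v.subst w).IsValue := hv.subst fun i => (hw i).typedBy.1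
  have htyped {n : ℕ} {Γ : Fin n → Ty} {γ : Fin n → ℝ≥0∞} {v : Term R S.Op n} {τ : Ty}
      (D : Deriv R S ε Γ γ v τ) {w : Fin n → Term R S.Op 0} {g : Env (Met.of R) Γ}
      (hw : ∀ i, Comp ρ hρ opDen opFun m (Γ i) (w i) (g i)) (hv : v.IsValue) :
      TypedBy ρ hρ opDen m τ (v.subst w) (denote ρ hρ opDen D g) := by
    choose Dw hDw using fun i => (hw i).typedBy.2
    obtain ⟨D', hD'⟩ :=
      hasDen_subst_closed (hρ := hρ) (opDen := opDen) D (fun i => (hw i).typedBy.1) Dw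
    exact ⟨hval hw hv, D', hD' ▸ agree_denote hS m D hDw⟩
  have hcomp {n : ℕ} {w : Fin n → Term R S.Op 0} {v : Term R S.Op n} {τ : Ty}
      {a : τ.den (Met.of R)} (hv : (v.subst w).IsValue)
      (h : ∃ u, Eval opFun (roundOf ρ m) (v.subst w) u ∧ Comp ρ hρ opDen opFun m τ u a) :
      Comp ρ hρ opDen opFun m τ (v.subst w) a := by
    obtain ⟨u, h, hu⟩ := h
    exact h.eq_of_isValue hv ▸ hu
  induction D with
  | unit => exact ⟨_, .val .star, htyped .unit hw .star⟩
  | const k => exact ⟨_, .val (.const k), htyped (.const k) hw (.const k), rfl⟩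
  | var i hi => exact ⟨_, .val (hw i).typedBy.1, hw i⟩
  | lam De ih =>
    refine ⟨_, .val (.lam _), htyped (.lam De) hw (.lam _), fun v a hv => ?_⟩
    obtain ⟨u, h, hu⟩ := ih (Comp.cons hw hv)
    exact ⟨u, .app hv.typedBy.1 ((Term.inst_subst_liftSub _ _ _).symm ▸ h), hu⟩
  | app hv₁ hv₂ Dv Dw ihv ihw =>
    exact (hcomp (hval hw hv₁) (ihv hw)).2 _ _ (hcomp (hval hw hv₂) (ihw hw))
  | apair hv₁ hv₂ Dv Dw ihv ihw =>
    exact ⟨_, .val (hval hw (.apair hv₁ hv₂)), htyped (.apair hv₁ hv₂ Dv Dw) hw (.apair hv₁ hv₂),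
      _, _, rfl, hcomp (hval hw hv₁) (ihv hw), hcomp (hval hw hv₂) (ihw hw)⟩
  | fst hv Dv ih =>
    obtain ⟨-, v₁, v₂, h, h₁, h₂⟩ := hcomp (hval hw hv) (ih hw)
    rw [Term.subst, h]
    exact ⟨v₁, .fst h₁.typedBy.1 h₂.typedBy.1, h₁⟩
  | snd hv Dv ih =>
    obtain ⟨-, v₁, v₂, h, h₁, h₂⟩ := hcomp (hval hw hv) (ih hw)
    rw [Term.subst, h]
    exact ⟨v₂, .snd h₁.typedBy.1 h₂.typedBy.1, h₂⟩
  | tpair hv₁ hv₂ Dv Dw ihv ihw =>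
    exact ⟨_, .val (hval hw (.tpair hv₁ hv₂)), htyped (.tpair hv₁ hv₂ Dv Dw) hw (.tpair hv₁ hv₂),
      _, _, rfl, hcomp (hval hw hv₁) (ihv hw), hcomp (hval hw hv₂) (ihw hw)⟩
  | letPair hv Dv De ihv ihe =>
    obtain ⟨-, v₁, v₂, h, h₁, h₂⟩ := hcomp (hval hw hv) (ihv hw)
    obtain ⟨u, hu, hu'⟩ := ihe (Comp.cons (Comp.cons hw h₁) h₂)
    rw [Term.subst, h]
    exact ⟨u, .letPair h₁.typedBy.1 h₂.typedBy.1
      ((Term.inst₂_subst_liftSub _ _ _ _).symm ▸ hu), hu'⟩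
  | inl hv Dv ih =>
    exact ⟨_, .val (hval hw (.inl hv)), htyped (.inl hv Dv) hw (.inl hv),
      .inl ⟨_, _, rfl, rfl, hcomp (hval hw hv) (ih hw)⟩⟩
  | inr hv Dv ih =>
    exact ⟨_, .val (hval hw (.inr hv)), htyped (.inr hv Dv) hw (.inr hv),
      .inr ⟨_, _, rfl, rfl, hcomp (hval hw hv) (ih hw)⟩⟩
  | case hs hv Dv De Df ihv ihe ihf =>
    obtain ⟨-, ⟨v, a, h, ha, h₁⟩ | ⟨v, a, h, ha, h₁⟩⟩ := hcomp (hval hw hv) (ihv hw)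
    · obtain ⟨u, hu, hu'⟩ := ihe (Comp.cons hw h₁)
      simp only [Term.subst, h, denote, caseHom, ha]
      exact ⟨u, .caseInl h₁.typedBy.1 ((Term.inst_subst_liftSub _ _ _).symm ▸ hu), hu'⟩
    · obtain ⟨u, hu, hu'⟩ := ihf (Comp.cons hw h₁)
      simp only [Term.subst, h, denote, caseHom, ha]
      exact ⟨u, .caseInr h₁.typedBy.1 ((Term.inst_subst_liftSub _ _ _).symm ▸ hu), hu'⟩
  | box hδ hv Dv ih =>
    exact ⟨_, .val (hval hw (.box hv)), htyped (.box hδ hv Dv) hw (.box hv),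
      _, rfl, hcomp (hval hw hv) (ih hw)⟩
  | letBox hv Dv De ihv ihe =>
    obtain ⟨-, v, h, h₁⟩ := hcomp (hval hw hv) (ihv hw)
    obtain ⟨u, hu, hu'⟩ := ihe (Comp.cons hw h₁)
    rw [Term.subst, h]
    exact ⟨u, .letBox h₁.typedBy.1 ((Term.inst_subst_liftSub _ _ _).symm ▸ hu), hu'⟩
  | letIn hs De Df ihe ihf =>
    obtain ⟨v, h, h₁⟩ := ihe hw
    obtain ⟨u, hu, hu'⟩ := ihf (Comp.cons hw h₁)
    exact ⟨u, .letIn h h₁.typedBy.1 ((Term.inst_subst_liftSub _ _ _).symm ▸ hu), hu'⟩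
  | ret hv Dv ih =>
    refine ⟨_, .val (hval hw (.ret hv)), htyped (.ret hv Dv) hw (.ret hv), _, rfl, ?_⟩
    have h := hcomp (hval hw hv) (ih hw)
    cases m <;> exact h
  | @rnd n Γ γ v hv Dv ih =>
    obtain ⟨-, h⟩ := hcomp (hval hw hv) (ih hw)
    have hsel : sel m (denote ρ hρ opDen (.rnd hv Dv) g).1 =
        roundOf ρ m (denote ρ hρ opDen Dv g) := by
      cases m <;> rfl
    -- The value denotes a pair with equal components, whereas `rnd v` denotes `(x, ρ x)`; the two
    -- agree in the component selected by `m`.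
    refine ⟨.ret (.const (roundOf ρ m (denote ρ hρ opDen Dv g))), ?_,
      ⟨.ret (.const _), .msub zero_le (.ret (.const _) (.const _)), ?_⟩, _, rfl,
      ⟨.const _, .const _, hsel.symm⟩, congrArg Term.const hsel.symm⟩
    · rw [Term.subst, h]
      exact .rnd _
    · refine Eq.trans ?_ hsel.symm
      cases m <;> rfl
  | msub hqr De ih =>
    obtain ⟨u, h, hu⟩ := ih hw
    exact ⟨u, h, hu.mon_mono hqr rfl⟩
  | letM De Df ihe ihf =>
    -- The body is evaluated at the component of `⟦e⟧` selected by `m`, which is also the argument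
    -- from which the component selected by `m` of the denotation is computed.
    obtain ⟨_, h, -, v, rfl, h₁⟩ := ihe hw
    obtain ⟨u, hu, hu'⟩ := ihf (Comp.cons hw h₁)
    refine ⟨u, .letM h h₁.typedBy.1 ((Term.inst_subst_liftSub _ _ _).symm ▸ hu),
      hu'.mon_mono le_add_self ?_⟩
    cases m <;> rfl
  | op o hv Dv ih =>
    obtain ⟨hv', D', hD'⟩ := (hcomp (hval hw hv) (ih hw)).typedBy
    have h := hop o ⟨_, hv', ⟨D'⟩⟩ D'
    rw [(agree_iff_eq (hS o)).1 hD'] at h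
    exact ⟨_, .op o _ ⟨hv', ⟨D'⟩⟩, ⟨.const _, .const _, h.symm⟩, congrArg Term.const h.symm⟩

end Soundness

end NumFuzz

theorem mainTheorem2 {R : Type u} [PseudoEMetricSpace R] (S : NumFuzz.Signature.{v})
    (hS : ∀ o : S.Op, (S.arg o).MonadFree) (ε : ENNReal) (ρ : R → R)
    (hρ : ∀ x : R, edist x (ρ x) ≤ ε)
    (opFun : ∀ o : S.Op, NumFuzz.ClosedValue R S ε (S.arg o) → R)
    (opDen : ∀ o : S.Op,
      NumFuzz.Met.Hom ((S.arg o).den (NumFuzz.Met.of R)) (NumFuzz.Met.of R))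
    (hop : ∀ (o : S.Op) (v : NumFuzz.ClosedValue R S ε (S.arg o))
      (D : NumFuzz.ClosedDeriv R S ε v.1 (S.arg o)),
      opDen o (NumFuzz.denoteClosed ρ hρ opDen D) = opFun o v)
    (e : NumFuzz.Term R S.Op 0) (r : ENNReal)
    (he : Nonempty (NumFuzz.ClosedDeriv R S ε e (.mon r .num))) :
    ∃ k_id k_fp : R,
      NumFuzz.Steps opFun id e (.ret (.const k_id)) ∧
      NumFuzz.Steps opFun ρ e (.ret (.const k_fp)) ∧
      (∀ v : NumFuzz.Term R S.Op 0,
        NumFuzz.Steps opFun id e (.ret v) → v = .const k_id) ∧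
      (∀ v : NumFuzz.Term R S.Op 0,
        NumFuzz.Steps opFun ρ e (.ret v) → v = .const k_fp) ∧
      edist k_id k_fp ≤ r := by
  obtain ⟨D⟩ := he
  have key (m : Bool) : NumFuzz.Eval opFun (NumFuzz.roundOf ρ m) e
      (.ret (.const (NumFuzz.sel m (NumFuzz.denoteClosed ρ hρ opDen D).1))) := by
    obtain ⟨_, h, -, v, rfl, -, hv⟩ := NumFuzz.exists_eval_comp hS hop m D (w := fun i => i.elim0)
      (g := fun i => i.elim0) (fun i => i.elim0)
    rw [NumFuzz.Term.subst_closed, hv] at h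
    exact h
  exact ⟨_, _, (key false).steps, (key true).steps,
    fun v h => NumFuzz.Term.ret.inj (h.eval_ret.unique (key false)),
    fun v h => NumFuzz.Term.ret.inj (h.eval_ret.unique (key true)),
    (NumFuzz.denoteClosed ρ hρ opDen D).2⟩
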